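/- Let $\pi$ be a set of primes and $\pi'$ its complement in the set of all primes; a $\pi'$-number is a positive integer all of whose prime divisors lie in $\pi'$, and similarly for $\pi$. Let $G$ be a finite group with a series of subgroups $$1=H_0<H_1\le H_2\le\cdots\le H_{t-1}\le H_t=G\qquad(t\ge 1)$$ such that, for every $i=0,1,\ldots,t-1$, the index $|H_{i+1}:H_i|$ is divisible by at most one prime of $\pi$. Suppose also that $G$ has a subgroup $T$ such that $G=H_1T$ and $|G:T|$ is a $\pi'$-number. Suppose that, for every $i=1,\ldots,t$, the subgroup $H_i$ is quasinormal in $T$, meaning that $H_iK=KH_i$ for every subgroup $K$ of $T$ (it is not required that $H_i\le T$). Then $G$ is a $D^{S}_{\pi}$-group; that is, calling a subgroup a Hall $\pi$-subgroup of $G$ if its order is a $\pi$-number and its index in $G$ is a $\pi'$-number: 1. $G$ has a soluble Hall $\pi$-subgroup; 2. any two Hall $\pi$-subgroups of $G$ are conjugate in $G$; 3. every subgroup of $G$ whose order is a $\pi$-number is contained in some Hall $\pi$-subgroup of $G$. -/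

import Mathlib

open scoped Pointwise

namespace PiGroup

/-- `n` is a `π`-number: every prime divisor of `n` belongs to `π`. -/
def IsPiNumber (π : Set ℕ) (n : ℕ) : Prop :=
  ∀ p : ℕ, p.Prime → p ∣ n → p ∈ π

/-- `π'`, the complement of `π` in the set of all primes. -/
def primeCompl (π : Set ℕ) : Set ℕ :=
  {p | p.Prime ∧ p ∉ π}

/-- `n` is divisible by at most one prime of `π`. -/
def AtMostOnePrime (π : Set ℕ) (n : ℕ) : Prop :=
  ∀ p ∈ π, ∀ q ∈ π, p ∣ n → q ∣ n → p = q

variable {G : Type*} [Group G]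

/-- `A` permutes with `B`: `AB = BA` as sets. -/
def Permutes (A B : Subgroup G) : Prop :=
  (A : Set G) * (B : Set G) = (B : Set G) * (A : Set G)

/-- `A` is quasinormal in `B`: `A` permutes with every subgroup of `B`
(`A` need not be contained in `B`). -/
def IsQuasinormalIn (A B : Subgroup G) : Prop :=
  ∀ K : Subgroup G, K ≤ B → Permutes A K

/-- `H` is a `π`-subgroup: its order is a `π`-number. -/
def IsPiSubgroup (π : Set ℕ) (H : Subgroup G) : Prop :=
  IsPiNumber π (Nat.card H)

/-- `H` is a Hall `π`-subgroup: its order is a `π`-number and its index a `π'`-number. -/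
def IsHall (π : Set ℕ) (H : Subgroup G) : Prop :=
  IsPiSubgroup π H ∧ IsPiNumber (primeCompl π) H.index

/-- `H` and `K` are conjugate: `K = g H g⁻¹` for some `g`. -/
def AreConj (H K : Subgroup G) : Prop :=
  ∃ g : G, K = H.map (MulAut.conj g).toMonoidHom

variable (G)

/-- `E_π`-group: there is a Hall `π`-subgroup. -/
def IsEGroup (π : Set ℕ) : Prop :=
  ∃ H : Subgroup G, IsHall π H

/-- `C_π`-group: an `E_π`-group in which any two Hall `π`-subgroups are conjugate. -/
def IsCGroup (π : Set ℕ) : Prop :=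
  IsEGroup G π ∧ ∀ H K : Subgroup G, IsHall π H → IsHall π K → AreConj H K

/-- `C^S_π`-group: a `C_π`-group with a soluble Hall `π`-subgroup. -/
def IsCSGroup (π : Set ℕ) : Prop :=
  (∃ H : Subgroup G, IsHall π H ∧ Group.IsSolvable H) ∧ IsCGroup G π

/-- `D^S_π`-group: a `C^S_π`-group in which every `π`-subgroup lies in some Hall
`π`-subgroup. -/
def IsDSGroup (π : Set ℕ) : Prop :=
  IsCSGroup G π ∧
    ∀ U : Subgroup G, IsPiSubgroup π U → ∃ H : Subgroup G, IsHall π H ∧ U ≤ H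

end PiGroup

/-! Since `|G : T|` is a `π'`-number, a Sylow `q`-subgroup of `T` with `q ∈ π` is Sylow in `G`. As
`G = H_i T`, each conjugate of it in `G` is an `H_i`-conjugate of a subgroup of `T`, so `H_i`
permutes with all Sylow `q`-subgroups of `G`. This weaker condition, `HasPermutableChain`, replaces
the hypothesis because quotients and normal subgroups inherit it.

In a simple group, let `A` be the last proper term of the chain. If `A = 1`, the group order is the
last index of the chain. If not, Kegel's lemma gives `G = AQ` for each Sylow `q`-subgroup `Q ≠ 1`
with `q ∈ π`, so `|G : A|` is a power of each such `q`. Either way at most one prime of `π` divides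
`|G|`, and this extends to minimal normal subgroups.

By induction on `|G|` it remains to lift a soluble Hall subgroup containing a conjugate of every
`π`-subgroup (`HasDominantHall`) from `G/N` to `G`, where `N` is normal and `|N|` has at most one
prime `p` of `π` (`HasDominantHall.of_quotient`). Let `P` be a Sylow `p`-subgroup of `N`. The
Frattini argument moves the problem to the normaliser of `P`; modulo `P` the extension is coprime,
and Schur–Zassenhaus and Glauberman's lemma settle it. That every `π`-subgroup can be conjugated
into this normaliser is `exists_sylow_le_normalizer`. All acting groups turn out to be soluble, so
the odd order theorem is not needed. -/

open scoped Pointwise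

universe u

namespace PiGroup

/-! ### Fixed points of coprime actions -/

section FixedPoints

variable {Γ Ω : Type*} [Group Γ] [MulAction Γ Ω]

/-- The action of a subgroup on a subset that it stabilises. -/
@[reducible] def restrictAction (S : Subgroup Γ) (Θ : Set Ω) (h : ∀ s ∈ S, ∀ ω ∈ Θ, s • ω ∈ Θ) :
    MulAction S Θ where
  smul s ω := ⟨(s : Γ) • (ω : Ω), h s s.2 ω ω.2⟩
  one_smul ω := Subtype.ext (one_smul Γ (ω : Ω))
  mul_smul s t ω := Subtype.ext (mul_smul (s : Γ) (t : Γ) (ω : Ω))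

theorem card_modEq_card_fixed {r : ℕ} [Fact r.Prime] (S : Subgroup Γ) (hS : IsPGroup r S)
    (Θ : Set Ω) (hΘ : Θ.Finite) (h : ∀ s ∈ S, ∀ ω ∈ Θ, s • ω ∈ Θ) :
    Nat.card Θ ≡ Nat.card {ω ∈ Θ | ∀ s ∈ S, s • ω = ω} [MOD r] := by
  let := restrictAction S Θ h
  have := hΘ.to_subtype
  have e : MulAction.fixedPoints S Θ ≃ {ω | ω ∈ Θ ∧ ∀ s ∈ S, s • ω = ω} :=
    { toFun := fun x => ⟨x.1.1, x.1.2, fun s hs => congrArg Subtype.val (x.2 ⟨s, hs⟩)⟩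
      invFun := fun x => ⟨⟨x.1, x.2.1⟩, fun s => Subtype.ext (x.2.2 s s.2)⟩
      left_inv := fun x => rfl
      right_inv := fun x => rfl }
  have := hS.card_modEq_card_fixedPoints Θ
  rwa [Nat.card_congr e] at this

theorem exists_fixed_of_not_dvd {r : ℕ} [Fact r.Prime] (S : Subgroup Γ) (hS : IsPGroup r S)
    (Θ : Set Ω) (h : ∀ s ∈ S, ∀ ω ∈ Θ, s • ω ∈ Θ) (hr : ¬ r ∣ Nat.card Θ) :
    ∃ ω ∈ Θ, ∀ s ∈ S, s • ω = ω := by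
  let := restrictAction S Θ h
  obtain ⟨x, hx⟩ := hS.nonempty_fixed_point_of_prime_not_dvd_card Θ hr
  exact ⟨x.1, x.2, fun s hs => congrArg Subtype.val (hx ⟨s, hs⟩)⟩

theorem card_modEq_card_commuting {r : ℕ} [Fact r.Prime] (S : Subgroup Γ) (hS : IsPGroup r S)
    (X : Set Γ) (hX : X.Finite) (h : ∀ s ∈ S, ∀ x ∈ X, s * x * s⁻¹ ∈ X) :
    Nat.card X ≡ Nat.card {x ∈ X | ∀ s ∈ S, s * x = x * s} [MOD r] := by
  have h1 : Nat.card X ≡ Nat.card {x ∈ X | ∀ s ∈ S, s * x * s⁻¹ = x} [MOD r] :=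
    @card_modEq_card_fixed Γ Γ _ (MulAction.compHom Γ (MulAut.conj : Γ →* MulAut Γ)) r _ S hS X hX h
  simpa only [mul_inv_eq_iff_eq_mul] using h1

theorem exists_commuting_of_not_dvd {r : ℕ} [Fact r.Prime] (S : Subgroup Γ) (hS : IsPGroup r S)
    (X : Set Γ) (h : ∀ s ∈ S, ∀ x ∈ X, s * x * s⁻¹ ∈ X) (hr : ¬ r ∣ Nat.card X) :
    ∃ x ∈ X, ∀ s ∈ S, s * x = x * s := by
  obtain ⟨x, hx, hf⟩ := @exists_fixed_of_not_dvd Γ Γ _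
    (MulAction.compHom Γ (MulAut.conj : Γ →* MulAut Γ)) r _ S hS X h hr
  exact ⟨x, hx, fun s hs => mul_inv_eq_iff_eq_mul.1 (hf s hs)⟩

theorem card_dvd_of_transitive (C : Subgroup Γ) (Θ : Set Ω) {ω : Ω} (hω : ω ∈ Θ)
    (h : ∀ c ∈ C, ∀ ω ∈ Θ, c • ω ∈ Θ) (ht : ∀ ω' ∈ Θ, ∃ c ∈ C, c • ω = ω') :
    Nat.card Θ ∣ Nat.card C := by
  have e : MulAction.orbit C ω = Θ := by
    ext x
    constructor
    · rintro ⟨c, rfl⟩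
      exact h c c.2 ω hω
    · intro hx
      obtain ⟨c, hc, hcx⟩ := ht x hx
      exact ⟨⟨c, hc⟩, hcx⟩
  rw [← e, Nat.card_congr (MulAction.orbitEquivQuotientStabilizer C ω), ← Subgroup.index_eq_card]
  exact Subgroup.index_dvd_card _

/-- A nonempty transporter is a coset of a stabiliser. -/
theorem card_transporter_dvd (C : Subgroup Γ) {ω ω' : Ω} (h : ∃ c ∈ C, c • ω = ω') :
    Nat.card {c : Γ | c ∈ C ∧ c • ω = ω'} ∣ Nat.card C := by
  obtain ⟨c₀, hc₀, h₀⟩ := h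
  have e : MulAction.stabilizer C ω ≃ {c : Γ | c ∈ C ∧ c • ω = ω'} :=
    { toFun := fun x => ⟨c₀ * x.1.1, C.mul_mem hc₀ x.1.2, by
        have : x.1.1 • ω = ω := x.2
        rw [mul_smul, this, h₀]⟩
      invFun := fun x => ⟨⟨c₀⁻¹ * x.1, C.mul_mem (C.inv_mem hc₀) x.2.1⟩, by
        change (c₀⁻¹ * x.1) • ω = ω
        rw [mul_smul, x.2.2, ← h₀, inv_smul_smul]⟩
      left_inv := fun x => by ext; simp
      right_inv := fun x => by ext; simp }
  rw [← Nat.card_congr e]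
  exact Subgroup.card_subgroup_dvd_card _

end FixedPoints

/-! ### Prime-power sections at the top and bottom of a soluble group -/

section Solvable

/-- Take `K` maximal among the proper subgroups containing the derived subgroup; a Sylow
`r`-subgroup with `r` dividing `|U : K|` is not inside `K`. -/
theorem exists_normal_sup_sylow {U : Type*} [Group U] [Finite U] [Group.IsSolvable U]
    [Nontrivial U] :
    ∃ (K S : Subgroup U) (r : ℕ), K.Normal ∧ K < ⊤ ∧ r.Prime ∧ r ∣ Nat.card U ∧ IsPGroup r S ∧
      K ⊔ S = ⊤ := by
  obtain ⟨K, hK, hle⟩ := (eq_top_or_exists_le_coatom (commutator U)).resolve_left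
    (Group.IsSolvable.commutator_lt_top_of_nontrivial U).ne
  have hN : K.Normal := Subgroup.Normal.of_commutator_le U hle
  have hi : K.index ≠ 1 := fun h => hK.1 (Subgroup.index_eq_one.1 h)
  obtain ⟨r, hr, hrd⟩ := Nat.exists_prime_and_dvd hi
  have := Fact.mk hr
  let S : Sylow r U := default
  refine ⟨K, S, r, hN, hK.lt_top, hr, hrd.trans K.index_dvd_card, S.2, ?_⟩
  refine hK.2 _ (lt_of_le_of_ne le_sup_left fun h => ?_)
  have hS : (S : Subgroup U) ≤ K := h ▸ le_sup_right
  exact S.not_dvd_index (hrd.trans (Subgroup.index_dvd_of_le hS))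

/-- A minimal normal subgroup is abelian, so its Sylow subgroups are characteristic in it and normal
in `U`. -/
theorem exists_normal_isPGroup {U : Type*} [Group U] [Finite U] [Group.IsSolvable U]
    [Nontrivial U] :
    ∃ (R : Subgroup U) (r : ℕ), R.Normal ∧ R ≠ ⊥ ∧ r.Prime ∧ r ∣ Nat.card U ∧ IsPGroup r R := by
  obtain ⟨A, ⟨hA, hA0⟩, hmin⟩ := (Set.toFinite {A : Subgroup U | A.Normal ∧ A ≠ ⊥}).exists_minimal
    ⟨⊤, inferInstance, top_ne_bot⟩
  have hcomm : ⁅A, A⁆ = ⊥ := by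
    by_contra hne
    have hlt := Group.IsSolvable.commutator_lt_of_ne_bot hA0
    exact hlt.not_ge (hmin ⟨inferInstance, hne⟩ hlt.le)
  have hcA : ∀ a b : A, a * b = b * a := by
    intro a b
    have := Subgroup.commutator_eq_bot_iff_le_centralizer.1 hcomm a.2
    exact Subtype.ext ((Subgroup.mem_centralizer_iff.1 this b b.2).symm)
  have h1 : Nat.card A ≠ 1 := fun h => hA0 (Subgroup.card_eq_one.1 h)
  obtain ⟨r, hr, hrd⟩ := Nat.exists_prime_and_dvd h1
  have := Fact.mk hr
  let S : Sylow r A := default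
  have hSn : (S : Subgroup A).Normal := ⟨fun n hn g => by
    rw [hcA g n, mul_assoc, mul_inv_cancel, mul_one]; exact hn⟩
  have : (S : Subgroup A).Characteristic := S.characteristic_of_normal hSn
  refine ⟨(S : Subgroup A).map A.subtype, r, inferInstance, ?_, hr,
    hrd.trans A.card_subgroup_dvd_card, S.2.map _⟩
  rw [Ne, Subgroup.map_eq_bot_iff_of_injective _ A.subtype_injective]
  exact S.ne_bot_of_dvd_card hrd

end Solvable

/-- Glauberman's lemma: if the soluble group `U` acts coprimely on `C`, and `C` is transitive on
`Θ` compatibly with `U`, then `U` has fixed points on `Θ`, on which `C_C(U)` is transitive. -/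
theorem glauberman {Γ Ω : Type*} [Group Γ] [Finite Γ] [MulAction Γ Ω] (n : ℕ) :
    ∀ U C : Subgroup Γ, Nat.card U ≤ n → Group.IsSolvable U → U ≤ Subgroup.normalizer (C : Set Γ) →
    (Nat.card U).Coprime (Nat.card C) → ∀ Θ : Set Ω, Θ.Nonempty →
    (∀ u ∈ U, ∀ ω ∈ Θ, u • ω ∈ Θ) → (∀ c ∈ C, ∀ ω ∈ Θ, c • ω ∈ Θ) →
    (∀ ω ∈ Θ, ∀ ω' ∈ Θ, ∃ c ∈ C, c • ω = ω') →
    (∃ ω ∈ Θ, ∀ u ∈ U, u • ω = ω) ∧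
    ∀ ω ∈ Θ, ∀ ω' ∈ Θ, (∀ u ∈ U, u • ω = ω) → (∀ u ∈ U, u • ω' = ω') →
      ∃ c ∈ C, (∀ u ∈ U, u * c = c * u) ∧ c • ω = ω' := by
  induction n with
  | zero =>
    intro U C h
    exact absurd h (Nat.not_le.2 Nat.card_pos)
  | succ n ih =>
    intro U C hcard hsol hnorm hcop Θ hne hU hC htrans
    rcases subsingleton_or_nontrivial U with hs | hnt
    · have h1 : ∀ u ∈ U, u = 1 := fun u hu => congrArg Subtype.val (Subsingleton.elim (⟨u, hu⟩ : U) 1)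
      obtain ⟨ω, hω⟩ := hne
      refine ⟨⟨ω, hω, fun u hu => by rw [h1 u hu, one_smul]⟩, fun ω hω ω' hω' _ _ => ?_⟩
      obtain ⟨c, hc, h⟩ := htrans ω hω ω' hω'
      exact ⟨c, hc, fun u hu => by rw [h1 u hu, one_mul, mul_one], h⟩
    obtain ⟨K₀, S₀, r, hKn, hKlt, hr, hrU, hS₀, hsup⟩ := exists_normal_sup_sylow (U := U)
    have := Fact.mk hr
    set K : Subgroup Γ := K₀.map U.subtype with hK
    set S : Subgroup Γ := S₀.map U.subtype with hSdef
    have hKU : K ≤ U := Subgroup.map_subtype_le K₀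
    have hSU : S ≤ U := Subgroup.map_subtype_le S₀
    have hSp : IsPGroup r S := hS₀.map _
    have hKcard : Nat.card K = Nat.card K₀ :=
      Subgroup.card_map_of_injective U.subtype_injective
    have hKsol : Group.IsSolvable K :=
      Group.isSolvable_of_surjective (U.subtype.subgroupMap_surjective K₀)
    have hconj : ∀ u ∈ U, ∀ k ∈ K, u * k * u⁻¹ ∈ K := by
      rintro u hu _ ⟨k, hk, rfl⟩
      exact ⟨⟨u, hu⟩ * k * ⟨u, hu⟩⁻¹, hKn.conj_mem k hk _, rfl⟩
    -- `U = KS`: induction handles `K`, and counting modulo `r` handles the `r`-group `S`.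
    have hdec : ∀ u ∈ U, ∃ k ∈ K, ∃ s ∈ S, u = k * s := by
      intro u hu
      have : (⟨u, hu⟩ : U) ∈ K₀ ⊔ S₀ := hsup ▸ Subgroup.mem_top _
      obtain ⟨k, hk, s, hs, h⟩ := Subgroup.mem_sup_of_normal_left.1 this
      exact ⟨k, ⟨k, hk, rfl⟩, s, ⟨s, hs, rfl⟩, (congrArg Subtype.val h).symm⟩
    have hcardlt : Nat.card K ≤ n := by
      have : Nat.card K₀ < Nat.card U := by
        refine lt_of_le_of_ne (Subgroup.card_le_card_group K₀) fun h => hKlt.ne ?_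
        exact Subgroup.eq_top_of_card_eq _ h
      omega
    have hcopK : (Nat.card K).Coprime (Nat.card C) :=
      hcop.coprime_dvd_left (Subgroup.card_dvd_of_le hKU)
    obtain ⟨⟨ω₀, hω₀, hfix₀⟩, htr⟩ := ih K C hcardlt hKsol (hKU.trans hnorm) hcopK Θ hne
      (fun k hk => hU k (hKU hk)) hC htrans
    have hrC : ¬ r ∣ Nat.card C := fun h =>
      hr.one_lt.ne' (Nat.dvd_one.1 (hcop ▸ Nat.dvd_gcd hrU h))
    let Θ₁ : Set Ω := {ω ∈ Θ | ∀ k ∈ K, k • ω = ω}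
    let C₁ : Subgroup Γ := C ⊓ Subgroup.centralizer (K : Set Γ)
    have hC₁ : ∀ c ∈ C₁, ∀ k ∈ K, k * c = c * k := fun c hc k hk =>
      Subgroup.mem_centralizer_iff.1 hc.2 k hk
    have hrC₁ : ¬ r ∣ Nat.card C₁ := fun h => hrC (h.trans (Subgroup.card_dvd_of_le inf_le_left))
    have hUΘ₁ : ∀ u ∈ U, ∀ ω ∈ Θ₁, u • ω ∈ Θ₁ := by
      rintro u hu ω ⟨hω, hf⟩
      refine ⟨hU u hu ω hω, fun k hk => ?_⟩
      have := hf _ (hconj u⁻¹ (U.inv_mem hu) k hk)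
      rw [inv_inv] at this
      conv_rhs => rw [← this]
      rw [← mul_smul, ← mul_smul]
      congr 1
      group
    have hCΘ₁ : ∀ c ∈ C₁, ∀ ω ∈ Θ₁, c • ω ∈ Θ₁ := by
      rintro c hc ω ⟨hω, hf⟩
      refine ⟨hC c hc.1 ω hω, fun k hk => ?_⟩
      rw [← mul_smul, hC₁ c hc k hk, mul_smul, hf k hk]
    have htr₁ : ∀ ω ∈ Θ₁, ∀ ω' ∈ Θ₁, ∃ c ∈ C₁, c • ω = ω' := by
      intro ω hω ω' hω'
      obtain ⟨c, hc, hcK, h⟩ := htr ω hω.1 ω' hω'.1 hω.2 hω'.2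
      exact ⟨c, ⟨hc, Subgroup.mem_centralizer_iff.2 hcK⟩, h⟩
    refine ⟨?_, ?_⟩
    -- `|Θ₁|` divides `|C₁|`, which is prime to `r`, so `S` fixes a point of `Θ₁`.
    · have hd := card_dvd_of_transitive C₁ Θ₁ (ω := ω₀) ⟨hω₀, hfix₀⟩ hCΘ₁ (htr₁ ω₀ ⟨hω₀, hfix₀⟩)
      obtain ⟨ω, hω, hf⟩ := exists_fixed_of_not_dvd S hSp Θ₁ (fun s hs => hUΘ₁ s (hSU hs))
        (fun h => hrC₁ (h.trans hd))
      refine ⟨ω, hω.1, fun u hu => ?_⟩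
      obtain ⟨k, hk, s, hs, rfl⟩ := hdec u hu
      rw [mul_smul, hf s hs, hω.2 k hk]
    · intro ω hω ω' hω' hf hf'
      -- `S` acts by conjugation on the elements of `C₁` taking `ω` to `ω'`; their number is prime
      -- to `r`, so one of them commutes with `S`.
      have hd := card_transporter_dvd C₁
        (htr₁ ω ⟨hω, fun k hk => hf k (hKU hk)⟩ ω' ⟨hω', fun k hk => hf' k (hKU hk)⟩)
      have hr' : ¬ r ∣ Nat.card {c : Γ | c ∈ C₁ ∧ c • ω = ω'} := fun h => hrC₁ (h.trans hd)
      have hst : ∀ s ∈ S, ∀ c ∈ {c : Γ | c ∈ C₁ ∧ c • ω = ω'},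
          s * c * s⁻¹ ∈ {c : Γ | c ∈ C₁ ∧ c • ω = ω'} := by
        rintro s hs c ⟨hc, hcω⟩
        have hsU := hSU hs
        refine ⟨⟨(Subgroup.mem_normalizer_iff.1 (hnorm hsU) c).1 hc.1, ?_⟩, ?_⟩
        · refine Subgroup.mem_centralizer_iff.2 fun k hk => ?_
          have h1 := hC₁ c hc _ (hconj s⁻¹ (U.inv_mem hsU) k hk)
          rw [inv_inv] at h1
          calc k * (s * c * s⁻¹) = s * (s⁻¹ * k * s * c) * s⁻¹ := by group
            _ = s * (c * (s⁻¹ * k * s)) * s⁻¹ := by rw [h1]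
            _ = s * c * s⁻¹ * k := by group
        · rw [mul_smul, mul_smul, inv_smul_eq_iff.2 (hf s hsU).symm, hcω, hf' s hsU]
      obtain ⟨c, hc, hcS⟩ := exists_commuting_of_not_dvd S hSp _ hst hr'
      refine ⟨c, hc.1.1, fun u hu => ?_, hc.2⟩
      obtain ⟨k, hk, s, hs, rfl⟩ := hdec u hu
      rw [mul_assoc, hcS s hs, ← mul_assoc, hC₁ c hc.1 k hk, mul_assoc]

/-! ### Sylow subgroups invariant under a soluble group -/

theorem card_map_mul_card_ker_inf {A B : Type*} [Group A] [Group B] (f : A →* B)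
    (K : Subgroup A) :
    Nat.card (K.map f) * Nat.card (f.ker ⊓ K : Subgroup A) = Nat.card K := by
  have h := Subgroup.relIndex_mul_relIndex ⊥ (f.ker ⊓ K) K bot_le inf_le_right
  rw [Subgroup.relIndex_bot_left, Subgroup.relIndex_bot_left, Subgroup.inf_relIndex_right,
    Subgroup.relIndex_ker, mul_comm] at h
  exact h

/-- `P` is a Sylow `p`-subgroup of the subgroup `N`. -/
structure IsSylowIn {Γ : Type*} [Group Γ] (p : ℕ) (P N : Subgroup Γ) : Prop where
  le : P ≤ N
  isPGroup : IsPGroup p P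
  not_dvd : ¬ p ∣ P.relIndex N

namespace IsSylowIn

variable {Γ : Type*} [Group Γ] {p : ℕ} {P N : Subgroup Γ}

theorem smul (h : IsSylowIn p P N) {g : Γ} (hg : g ∈ Subgroup.normalizer (N : Set Γ)) :
    IsSylowIn p (MulAut.conj g • P) N := by
  have hN : MulAut.conj g • N = N := Subgroup.conjAct_pointwise_smul_eq_self hg
  refine ⟨?_, h.isPGroup.map _, ?_⟩
  · conv_rhs => rw [← hN]
    exact Subgroup.pointwise_smul_le_pointwise_smul_iff.2 h.le
  · conv in (_ • P).relIndex N => rw [← hN]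
    rw [Subgroup.relIndex_pointwise_smul]
    exact h.not_dvd

theorem exists_of_subgroup [Finite Γ] [Fact p.Prime] (N : Subgroup Γ) :
    ∃ P, IsSylowIn p P N := by
  let S : Sylow p N := default
  refine ⟨(S : Subgroup N).map N.subtype, Subgroup.map_subtype_le _, S.2.map _, ?_⟩
  have : ((S : Subgroup N).map N.subtype).relIndex N = (S : Subgroup N).index := by
    rw [Subgroup.relIndex, Subgroup.subgroupOf, Subgroup.comap_map_eq_self_of_injective
      N.subtype_injective]
  rw [this]
  exact S.not_dvd_index

theorem exists_conj [Finite Γ] [Fact p.Prime] {P' : Subgroup Γ} (h : IsSylowIn p P N)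
    (h' : IsSylowIn p P' N) : ∃ n ∈ N, MulAut.conj n • P = P' := by
  let S : Sylow p N := IsPGroup.toSylow (P := P.subgroupOf N) h.isPGroup.comap_subtype h.not_dvd
  let S' : Sylow p N :=
    IsPGroup.toSylow (P := P'.subgroupOf N) h'.isPGroup.comap_subtype h'.not_dvd
  obtain ⟨n, hn⟩ := MulAction.exists_smul_eq N S S'
  refine ⟨n, n.2, ?_⟩
  have h1 : MulAut.conj n • (P.subgroupOf N) = P'.subgroupOf N :=
    congrArg (fun S : Sylow p N => (S : Subgroup N)) hn
  rw [Subgroup.conj_smul_subgroupOf h.le] at h1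
  have h2 : MulAut.conj (n : Γ) • P ≤ N := (h.smul (Subgroup.le_normalizer n.2)).le
  rw [Subgroup.subgroupOf_inj, inf_eq_left.2 h2, inf_eq_left.2 h'.le] at h1
  exact h1

/-- If `P` were not Sylow in `N`, then `p` would divide the index of `P` in its normaliser in `N`.
-/
theorem of_normalizer [Finite Γ] [Fact p.Prime]
    (h : IsSylowIn p P (N ⊓ Subgroup.normalizer (P : Set Γ))) : IsSylowIn p P N := by
  have hPN : P ≤ N := h.le.trans inf_le_left
  refine ⟨hPN, h.isPGroup, fun hd => h.not_dvd ?_⟩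
  obtain ⟨n, hn⟩ := IsPGroup.iff_card.1 h.isPGroup
  have hn' : Nat.card (P.subgroupOf N) = p ^ n := by
    rw [← hn]; exact Nat.card_congr (Subgroup.subgroupOfEquivOfLe hPN).toEquiv
  have hdvd : p ^ (n + 1) ∣ Nat.card N := by
    rw [← (P.subgroupOf N).card_mul_index, hn', pow_succ]
    exact mul_dvd_mul_left _ hd
  have key := Sylow.prime_dvd_card_quotient_normalizer hdvd hn'
  change p ∣ ((P.subgroupOf N).relIndex (Subgroup.normalizer (P.subgroupOf N : Set N))) at key
  rw [← Subgroup.subgroupOf_normalizer_eq hPN,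
    ← Subgroup.inf_subgroupOf_right (Subgroup.normalizer _), Subgroup.relIndex_subgroupOf inf_le_right, inf_comm] at key
  exact key

theorem map_of_injective {Γ' : Type*} [Group Γ'] {f : Γ →* Γ'} (hf : Function.Injective f)
    (h : IsSylowIn p P N) : IsSylowIn p (P.map f) (N.map f) :=
  ⟨Subgroup.map_mono h.le, h.isPGroup.map f, by
    rw [Subgroup.relIndex_map_map_of_injective _ _ hf]; exact h.not_dvd⟩

theorem exists_of_map {B : Type*} [Group B] (f : Γ →* B) (U N : Subgroup Γ)
    (hUN : U ≤ Subgroup.normalizer (N : Set Γ)) (hker : IsPGroup p (f.ker ⊓ N : Subgroup Γ))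
    {P' : Subgroup B} (hP' : IsSylowIn p P' (N.map f))
    (hU : U.map f ≤ Subgroup.normalizer (P' : Set B)) :
    ∃ P, IsSylowIn p P N ∧ f.ker ⊓ N ≤ P ∧ U ≤ Subgroup.normalizer (P : Set Γ) := by
  refine ⟨P'.comap f ⊓ N, ⟨inf_le_right, ?_, ?_⟩, ?_, ?_⟩
  · have h1 : IsPGroup p (f.comp N.subtype).ker := by
      rw [← MonoidHom.comap_ker]
      exact (hker.comap_subtype (K := N)).to_le (Subgroup.inf_subgroupOf_right f.ker N).ge
    have h2 := (hP'.isPGroup.comap_of_ker_isPGroup (f.comp N.subtype) h1).map N.subtype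
    rwa [← Subgroup.comap_comap, ← Subgroup.subgroupOf, Subgroup.subgroupOf_map_subtype] at h2
  · rw [Subgroup.inf_relIndex_right, Subgroup.relIndex_comap]
    exact hP'.not_dvd
  · exact inf_le_inf_right N fun x hx => by
      rw [Subgroup.mem_comap, MonoidHom.mem_ker.1 hx]; exact P'.one_mem
  · rw [Subgroup.le_normalizer_iff] at hUN hU ⊢
    rintro u hu x ⟨hx, hxN⟩
    refine ⟨?_, hUN u hu x hxN⟩
    change f (u * x * u⁻¹) ∈ P'
    simpa using hU (f u) ⟨u, hu, rfl⟩ (f x) hx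

end IsSylowIn

/-- The image of `K` in `N_Γ(L) / L`. -/
def quotientImage {Γ : Type*} [Group Γ] (L K : Subgroup Γ) :
    Subgroup (Subgroup.normalizer (L : Set Γ) ⧸ L.subgroupOf (Subgroup.normalizer (L : Set Γ))) :=
  (K.subgroupOf _).map (QuotientGroup.mk' _)

/-! ### Passing to the quotient of a normaliser -/

section quotientImage

variable {Γ : Type*} [Group Γ] {L K : Subgroup Γ}

theorem card_quotientImage_mul (hK : K ≤ Subgroup.normalizer (L : Set Γ)) :
    Nat.card (quotientImage L K) * Nat.card (L ⊓ K : Subgroup Γ) = Nat.card K := by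
  have h := card_map_mul_card_ker_inf
    (QuotientGroup.mk' (L.subgroupOf (Subgroup.normalizer (L : Set Γ)))) (K.subgroupOf _)
  rw [QuotientGroup.ker_mk', Nat.card_congr (Subgroup.subgroupOfEquivOfLe hK).toEquiv] at h
  have e : L.subgroupOf (Subgroup.normalizer (L : Set Γ)) ⊓ K.subgroupOf _ =
      (L ⊓ K).subgroupOf _ := (Subgroup.comap_inf _ _ _).symm
  rwa [e, Nat.card_congr (Subgroup.subgroupOfEquivOfLe (inf_le_right.trans hK)).toEquiv] at h

theorem isSolvable_quotientImage [hK : Group.IsSolvable K] :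
    Group.IsSolvable (quotientImage L K) := by
  have : Group.IsSolvable (K.subgroupOf (Subgroup.normalizer (L : Set Γ))) :=
    Group.isSolvable_of_isSolvable_injective
      (f := (Subgroup.normalizer (L : Set Γ)).subtype.subgroupComap K)
      (fun x y h => Subtype.ext (Subtype.ext (congrArg (fun z : K => (z : Γ)) h)))
  exact Group.isSolvable_of_surjective (MonoidHom.subgroupMap_surjective _ _)

theorem quotientImage_le_normalizer {U N : Subgroup Γ} (h : U ≤ Subgroup.normalizer (N : Set Γ)) :
    quotientImage L U ≤ Subgroup.normalizer (quotientImage L N : Set _) := by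
  rw [Subgroup.le_normalizer_iff] at h ⊢
  rintro _ ⟨u, hu, rfl⟩ _ ⟨x, hx, rfl⟩
  exact ⟨u * x * u⁻¹, h u hu x hx, by simp⟩

theorem IsSylowIn.exists_of_quotientImage {p : ℕ} {U N : Subgroup Γ}
    (hUL : U ≤ Subgroup.normalizer (L : Set Γ)) (hNL : N ≤ Subgroup.normalizer (L : Set Γ))
    (hUN : U ≤ Subgroup.normalizer (N : Set Γ)) (hker : IsPGroup p (L ⊓ N : Subgroup Γ))
    (h : ∃ P', IsSylowIn p P' (quotientImage L N) ∧
      quotientImage L U ≤ Subgroup.normalizer (P' : Set _)) :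
    ∃ P, IsSylowIn p P N ∧ L ⊓ N ≤ P ∧ U ≤ Subgroup.normalizer (P : Set Γ) := by
  obtain ⟨P', hP', hU⟩ := h
  set M := Subgroup.normalizer (L : Set Γ) with hM
  have hUN' : U.subgroupOf M ≤ Subgroup.normalizer (N.subgroupOf M : Set M) := by
    rw [Subgroup.le_normalizer_iff] at hUN ⊢
    exact fun u hu x hx => hUN u hu x hx
  obtain ⟨P, hP, hle, hUP⟩ := IsSylowIn.exists_of_map (QuotientGroup.mk' (L.subgroupOf M))
    (U.subgroupOf M) (N.subgroupOf M) hUN' (by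
      rw [QuotientGroup.ker_mk']
      exact (hker.comap_subtype (K := M)).to_le (Subgroup.comap_inf _ _ _).ge) hP' hU
  refine ⟨P.map M.subtype, ?_, ?_, ?_⟩
  · have := hP.map_of_injective M.subtype_injective
    rwa [Subgroup.subgroupOf_map_subtype, inf_eq_left.2 hNL] at this
  · rintro x ⟨hx, hxN⟩
    rw [QuotientGroup.ker_mk'] at hle
    exact ⟨⟨x, hNL hxN⟩, hle ⟨hx, hxN⟩, rfl⟩
  · rw [Subgroup.le_normalizer_iff] at hUP ⊢
    rintro u hu _ ⟨x, hx, rfl⟩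
    exact ⟨_, hUP ⟨u, hUL hu⟩ hu x hx, rfl⟩

end quotientImage

theorem conj_smul_eq_self_iff {Γ : Type*} [Group Γ] {g : Γ} {S : Subgroup Γ} :
    MulAut.conj g • S = S ↔ g ∈ Subgroup.normalizer (S : Set Γ) := by
  rw [Subgroup.mem_normalizer_iff_map_conj_eq]
  rfl

theorem le_normalizer_inf {Γ : Type*} [Group Γ] {U A B : Subgroup Γ}
    (hA : U ≤ Subgroup.normalizer (A : Set Γ)) (hB : U ≤ Subgroup.normalizer (B : Set Γ)) :
    U ≤ Subgroup.normalizer ((A ⊓ B : Subgroup Γ) : Set Γ) := by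
  rw [Subgroup.le_normalizer_iff] at *
  exact fun u hu x hx => ⟨hA u hu x hx.1, hB u hu x hx.2⟩

theorem le_normalizer_centralizer {Γ : Type*} [Group Γ] {U R : Subgroup Γ}
    (h : U ≤ Subgroup.normalizer (R : Set Γ)) :
    U ≤ Subgroup.normalizer (Subgroup.centralizer (R : Set Γ) : Set Γ) := by
  rw [Subgroup.le_normalizer_iff] at *
  intro u hu c hc
  refine Subgroup.mem_centralizer_iff.2 fun r hr => ?_
  have h1 := Subgroup.mem_centralizer_iff.1 hc _ (h u⁻¹ (U.inv_mem hu) r hr)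
  rw [inv_inv] at h1
  calc r * (u * c * u⁻¹) = u * (u⁻¹ * r * u * c) * u⁻¹ := by group
    _ = u * (c * (u⁻¹ * r * u)) * u⁻¹ := by rw [h1]
    _ = u * c * u⁻¹ * r := by group

theorem le_normalizer_normalizer {Γ : Type*} [Group Γ] {U R : Subgroup Γ}
    (h : U ≤ Subgroup.normalizer (R : Set Γ)) :
    U ≤ Subgroup.normalizer (Subgroup.normalizer (R : Set Γ) : Set Γ) :=
  h.trans Subgroup.le_normalizer

/-- If the soluble group `U` and the group `N` share no prime other than `p`, then `U` normalises
a Sylow `p`-subgroup of `N`. -/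
theorem exists_sylow_le_normalizer {p : ℕ} [hp : Fact p.Prime] (n : ℕ) :
    ∀ (Γ : Type u) [Group Γ] [Finite Γ] (U N : Subgroup Γ),
    Nat.card U + Nat.card N ≤ n → Group.IsSolvable U → U ≤ Subgroup.normalizer (N : Set Γ) →
    (∀ q : ℕ, q.Prime → q ∣ Nat.card U → q ∣ Nat.card N → q = p) →
    ∃ P, IsSylowIn p P N ∧ U ≤ Subgroup.normalizer (P : Set Γ) := by
  induction n with
  | zero =>
    intro Γ _ _ U N h
    have : 0 < Nat.card U := Nat.card_pos
    omega
  | succ n ih =>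
    -- `Q` is a maximal `U`-invariant `p`-subgroup of `N`; the aim is to show that it is Sylow, or
    -- to find a Sylow subgroup in another way.
    intro Γ _ _ U N hcard hsol hUN hpr
    obtain ⟨Q, ⟨hQN, hQp, hUQ⟩, hmax⟩ := (Set.toFinite {Q : Subgroup Γ | Q ≤ N ∧ IsPGroup p Q ∧
      U ≤ Subgroup.normalizer (Q : Set Γ)}).exists_maximal
      ⟨⊥, bot_le, IsPGroup.of_bot, Subgroup.le_normalizer_of_normal⟩
    have hmax' : ∀ Q' : Subgroup Γ, Q' ≤ N → IsPGroup p Q' →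
      U ≤ Subgroup.normalizer (Q' : Set Γ) → Q ≤ Q' → Q' ≤ Q := fun Q' h1 h2 h3 h4 =>
      hmax ⟨h1, h2, h3⟩ h4
    by_cases hQ : Q = ⊥
    swap
    -- For `Q ≠ 1`, induction in `N_N(Q)/Q` gives an invariant Sylow subgroup of `N_N(Q)` above `Q`.
    -- By maximality it is `Q`, so `Q` is Sylow in `N`.
    · set M := Subgroup.normalizer (Q : Set Γ) with hM
      set K := N ⊓ M with hK
      have hQK : Q ≤ K := le_inf hQN Subgroup.le_normalizer
      have hUK : U ≤ Subgroup.normalizer (K : Set Γ) :=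
        le_normalizer_inf hUN (le_normalizer_normalizer hUQ)
      have hUc := card_quotientImage_mul hUQ
      have hKc := card_quotientImage_mul (L := Q) (K := K) inf_le_right
      rw [inf_eq_left.2 hQK] at hKc
      have hQ1 : 1 < Nat.card Q := Subgroup.one_lt_card_iff_ne_bot _ |>.2 hQ
      have hKN : Nat.card K ∣ Nat.card N := Subgroup.card_dvd_of_le inf_le_left
      have h1 : Nat.card (quotientImage Q U) ≤ Nat.card U :=
        Nat.le_of_dvd Nat.card_pos ⟨_, hUc.symm⟩
      have h2 : Nat.card (quotientImage Q K) < Nat.card N := by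
        have h3 : Nat.card K ≤ Nat.card N := Nat.le_of_dvd Nat.card_pos hKN
        have h4 : 0 < Nat.card (quotientImage Q K) := Nat.card_pos
        nlinarith
      obtain ⟨P, hP, hQP, hUP⟩ := IsSylowIn.exists_of_quotientImage hUQ inf_le_right hUK
        hQp.to_inf_left (ih _ (quotientImage Q U) (quotientImage Q K) (by omega)
          isSolvable_quotientImage (quotientImage_le_normalizer hUK)
          (fun q hq hqU hqK => hpr q hq (hqU.trans ⟨_, hUc.symm⟩)
            ((hqK.trans ⟨_, hKc.symm⟩).trans hKN)))
      rw [inf_eq_left.2 hQK] at hQP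
      have hPQ : P = Q := le_antisymm (hmax' P (hP.le.trans inf_le_left) hP.isPGroup hUP hQP) hQP
      subst hPQ
      exact ⟨P, hP.of_normalizer, hUP⟩
    subst hQ
    have hbot : ∀ Q' : Subgroup Γ, Q' ≤ N → IsPGroup p Q' →
      U ≤ Subgroup.normalizer (Q' : Set Γ) → Q' = ⊥ := fun Q' h1 h2 h3 =>
      le_bot_iff.1 (hmax' Q' h1 h2 h3 bot_le)
    by_cases hpN : p ∣ Nat.card N
    swap
    · exact ⟨⊥, ⟨bot_le, IsPGroup.of_bot, by rwa [Subgroup.relIndex_bot_left]⟩, hUQ⟩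
    rcases subsingleton_or_nontrivial U with hs | hnt
    · obtain ⟨P, hP⟩ := IsSylowIn.exists_of_subgroup (p := p) N
      refine ⟨P, hP, fun u hu => ?_⟩
      rw [show u = 1 from congrArg Subtype.val (Subsingleton.elim (⟨u, hu⟩ : U) 1)]
      exact Subgroup.one_mem _
    obtain ⟨R₀, r, hR₀n, hR₀, hr, hrU, hR₀p⟩ := exists_normal_isPGroup (U := U)
    have := Fact.mk hr
    set R : Subgroup Γ := R₀.map U.subtype with hR
    have hRp : IsPGroup r R := hR₀p.map _
    have hRU : R ≤ U := Subgroup.map_subtype_le R₀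
    have hRbot : R ≠ ⊥ := by
      rwa [hR, Ne, Subgroup.map_eq_bot_iff_of_injective _ U.subtype_injective]
    have hRsol : Group.IsSolvable R :=
      Group.isSolvable_of_isSolvable_injective (Subgroup.inclusion_injective hRU)
    have hUR : U ≤ Subgroup.normalizer (R : Set Γ) := by
      rw [Subgroup.le_normalizer_iff]
      rintro u hu _ ⟨k, hk, rfl⟩
      exact ⟨⟨u, hu⟩ * k * ⟨u, hu⟩⁻¹, hR₀n.conj_mem k hk _, rfl⟩
    have hrN : r ≠ p → ¬ r ∣ Nat.card N := fun h h' => h (hpr r hr hrU h')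
    have hRcop : r ≠ p → (Nat.card R).Coprime (Nat.card N) := by
      intro h
      obtain ⟨k, hk⟩ := IsPGroup.iff_card.1 hRp
      rw [hk]
      exact Nat.Coprime.pow_left k ((Nat.Prime.coprime_iff_not_dvd hr).2 (hrN h))
    -- If `R` centralises `N`, then `R ∩ N = 1` and `R` can be factored out.
    by_cases hNR : N ≤ Subgroup.centralizer (R : Set Γ)
    · have hNR' : N ≤ Subgroup.normalizer (R : Set Γ) :=
        hNR.trans (Subgroup.centralizer_le_normalizer _)
      have hinf : R ⊓ N = ⊥ := by
        by_cases hrp : r = p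
        · subst hrp
          exact hbot _ inf_le_right hRp.to_inf_left (le_normalizer_inf hUR hUN)
        · exact (Subgroup.disjoint_of_coprime_natCard (hRcop hrp)).eq_bot
      have hUc := card_quotientImage_mul hUR
      have hNc := card_quotientImage_mul hNR'
      rw [inf_eq_left.2 hRU] at hUc
      have hR1 : 1 < Nat.card R := Subgroup.one_lt_card_iff_ne_bot _ |>.2 hRbot
      have h1 : Nat.card (quotientImage R N) ≤ Nat.card N :=
        Nat.le_of_dvd Nat.card_pos ⟨_, hNc.symm⟩
      have h2 : Nat.card (quotientImage R U) < Nat.card U := by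
        have h4 : 0 < Nat.card (quotientImage R U) := Nat.card_pos
        nlinarith
      obtain ⟨P, hP, -, hUP⟩ := IsSylowIn.exists_of_quotientImage hUR hNR' hUN
        (by rw [hinf]; exact IsPGroup.of_bot)
        (ih _ (quotientImage R U) (quotientImage R N) (by omega)
          isSolvable_quotientImage (quotientImage_le_normalizer hUN)
          (fun q hq hqU hqN => hpr q hq (hqU.trans ⟨_, hUc.symm⟩) (hqN.trans ⟨_, hNc.symm⟩)))
      exact ⟨P, hP, hUP⟩
    set C := N ⊓ Subgroup.centralizer (R : Set Γ) with hC
    have hUC : U ≤ Subgroup.normalizer (C : Set Γ) :=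
      le_normalizer_inf hUN (le_normalizer_centralizer hUR)
    have hCN : Nat.card C ∣ Nat.card N := Subgroup.card_dvd_of_le inf_le_left
    have hClt : Nat.card C < Nat.card N := by
      refine lt_of_le_of_ne (Nat.le_of_dvd Nat.card_pos hCN) fun h => hNR ?_
      rw [← inf_eq_left]
      exact Subgroup.eq_of_le_of_card_ge inf_le_left h.ge
    -- Induction gives a `U`-invariant Sylow `p`-subgroup of `C`, which is trivial because `Q = 1`
    -- was maximal.
    have hpC : ¬ p ∣ Nat.card C := by
      obtain ⟨P, hP, hUP⟩ := ih Γ U C (by omega) hsol hUC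
        fun q hq hqU hqC => hpr q hq hqU (hqC.trans hCN)
      have := hP.not_dvd
      rwa [hbot P (hP.le.trans inf_le_left) hP.isPGroup hUP, Subgroup.relIndex_bot_left] at this
    by_cases hrp : r = p
    -- `C` is the fixed-point set of the `p`-group `R` on `N`, so `p ∣ |N|` forces `p ∣ |C|`.
    · subst hrp
      have h1 := card_modEq_card_commuting R hRp (N : Set Γ) (Set.toFinite _)
        ((Subgroup.le_normalizer_iff.1 (hRU.trans hUN)))
      have e : {x ∈ (N : Set Γ) | ∀ s ∈ R, s * x = x * s} = (C : Set Γ) := by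
        ext x
        exact and_congr_right fun _ => Subgroup.mem_centralizer_iff.symm
      rw [e] at h1
      exact absurd ((Nat.ModEq.dvd_iff h1 dvd_rfl).1 hpN) hpC
    let : MulAction Γ (Subgroup Γ) := MulAction.compHom _ (MulAut.conj : Γ →* MulAut Γ)
    have hfix : ∀ (A S : Subgroup Γ), A ≤ Subgroup.normalizer (S : Set Γ) ↔ ∀ a ∈ A, a • S = S :=
      fun A S => forall₂_congr fun a _ => conj_smul_eq_self_iff.symm
    -- Glauberman's lemma is used twice: for `R` acting on `N`, making `C` transitive on the
    -- `R`-invariant Sylow subgroups, and then for `U` acting on `C`, whose orders are now coprime.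
    obtain ⟨⟨P₁, hP₁, hf₁⟩, htr⟩ := glauberman (Nat.card R) R N le_rfl hRsol (hRU.trans hUN)
      (hRcop hrp) {S | IsSylowIn p S N} (IsSylowIn.exists_of_subgroup N)
      (fun s hs S hS => hS.smul (hUN (hRU hs)))
      (fun s hs S hS => hS.smul (Subgroup.le_normalizer hs))
      (fun S hS S' hS' => hS.exists_conj hS')
    have hcopC : (Nat.card U).Coprime (Nat.card C) := by
      refine Nat.Coprime.symm (Nat.coprime_of_dvd fun q hq hqC hqU => hpC ?_)
      rwa [← hpr q hq hqU (hqC.trans hCN)]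
    obtain ⟨⟨P, hP, hf⟩, -⟩ := glauberman (Nat.card U) U C le_rfl hsol hUC hcopC
      {S | IsSylowIn p S N ∧ ∀ a ∈ R, a • S = S} ⟨P₁, hP₁, hf₁⟩
      (fun u hu S hS => ⟨hS.1.smul (hUN hu), fun a ha => by
        have h1 := hS.2 _ (Subgroup.le_normalizer_iff.1 hUR u⁻¹ (U.inv_mem hu) a ha)
        rw [inv_inv] at h1
        conv_rhs => rw [← h1]
        rw [← mul_smul, ← mul_smul]
        congr 1
        group⟩)
      (fun c hc S hS => ⟨hS.1.smul (Subgroup.le_normalizer hc.1), fun a ha => by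
        rw [← mul_smul, Subgroup.mem_centralizer_iff.1 hc.2 a ha, mul_smul, hS.2 a ha]⟩)
      (fun S hS S' hS' => by
        obtain ⟨c, hc, hcR, h⟩ := htr S hS.1 S' hS'.1 hS.2 hS'.2
        exact ⟨c, ⟨hc, Subgroup.mem_centralizer_iff.2 hcR⟩, h⟩)
    exact ⟨P, hP.1, (hfix U P).2 hf⟩

/-! ### Dominant soluble Hall subgroups -/

theorem IsPiNumber.of_dvd {π : Set ℕ} {m n : ℕ} (h : IsPiNumber π n) (hmn : m ∣ n) :
    IsPiNumber π m :=
  fun p hp hd => h p hp (hd.trans hmn)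

theorem IsPiNumber.mul {π : Set ℕ} {m n : ℕ} (hm : IsPiNumber π m) (hn : IsPiNumber π n) :
    IsPiNumber π (m * n) :=
  fun p hp hd => (hp.dvd_mul.1 hd).elim (hm p hp) (hn p hp)

theorem isPiNumber_primeCompl {π : Set ℕ} {n : ℕ} :
    IsPiNumber (primeCompl π) n ↔ ∀ p : ℕ, p.Prime → p ∈ π → ¬ p ∣ n :=
  ⟨fun h p hp hpπ hd => (h p hp hd).2 hpπ, fun h p hp hd => ⟨hp, fun hpπ => h p hp hpπ hd⟩⟩

theorem IsPiNumber.coprime {π : Set ℕ} {m n : ℕ} (hm : IsPiNumber π m)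
    (hn : IsPiNumber (primeCompl π) n) : m.Coprime n :=
  Nat.coprime_of_dvd fun p hp hpm hpn => (hn p hp hpn).2 (hm p hp hpm)

theorem IsPiSubgroup.mono {π : Set ℕ} {G : Type*} [Group G] {U V : Subgroup G}
    (hV : IsPiSubgroup π V) (h : U ≤ V) : IsPiSubgroup π U :=
  IsPiNumber.of_dvd hV (Subgroup.card_dvd_of_le h)

theorem IsPiSubgroup.map {π : Set ℕ} {G G' : Type*} [Group G] [Group G'] {U : Subgroup G}
    (hU : IsPiSubgroup π U) (f : G →* G') : IsPiSubgroup π (U.map f) :=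
  IsPiNumber.of_dvd hU (Subgroup.card_map_dvd U f)

/-- `G` has a soluble Hall `π`-subgroup containing a conjugate of every `π`-subgroup. -/
def HasDominantHall (π : Set ℕ) (G : Type*) [Group G] : Prop :=
  ∃ H : Subgroup G, IsHall π H ∧ Group.IsSolvable H ∧
    ∀ U : Subgroup G, IsPiSubgroup π U → ∃ g : G, U ≤ MulAut.conj g • H

theorem card_conj_smul {G : Type*} [Group G] (g : G) (H : Subgroup G) :
    Nat.card (MulAut.conj g • H : Subgroup G) = Nat.card H :=
  Subgroup.card_map_of_injective (MulAut.conj g).injective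

theorem IsHall.conj_smul {π : Set ℕ} {G : Type*} [Group G] {H : Subgroup G} (h : IsHall π H)
    (g : G) : IsHall π (MulAut.conj g • H) := by
  refine ⟨?_, ?_⟩
  · rw [IsPiSubgroup, card_conj_smul]
    exact h.1
  · have : (MulAut.conj g • H : Subgroup G).index = H.index := by
      have := Subgroup.relIndex_pointwise_smul (h := MulAut.conj g) H ⊤
      rwa [Subgroup.Normal.conj_smul_eq_self g ⊤, Subgroup.relIndex_top_right,
        Subgroup.relIndex_top_right] at this
    rw [this]
    exact h.2

theorem IsHall.eq_of_le {π : Set ℕ} {G : Type*} [Group G] [Finite G] {H K : Subgroup G}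
    (hH : IsHall π H) (hK : IsPiSubgroup π K) (hle : H ≤ K) : H = K := by
  refine le_antisymm hle (Subgroup.relIndex_eq_one.1 ?_)
  exact Nat.eq_one_of_dvd_coprimes (IsPiNumber.coprime hK hH.2) (Subgroup.relIndex_dvd_card H K)
    (Subgroup.relIndex_dvd_index_of_le hle)

theorem HasDominantHall.isDSGroup {π : Set ℕ} {G : Type*} [Group G] [Finite G]
    (h : HasDominantHall π G) : IsDSGroup G π := by
  obtain ⟨H, hH, hs, hd⟩ := h
  have key : ∀ K : Subgroup G, IsHall π K → ∃ g : G, K = MulAut.conj g • H := fun K hK => by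
    obtain ⟨g, hg⟩ := hd K hK.1
    exact ⟨g, hK.eq_of_le (hH.conj_smul g).1 hg⟩
  refine ⟨⟨⟨H, hH, hs⟩, ⟨H, hH⟩, fun A B hA hB => ?_⟩, fun U hU => ?_⟩
  · obtain ⟨a, rfl⟩ := key A hA
    obtain ⟨b, rfl⟩ := key B hB
    refine ⟨b * a⁻¹, ?_⟩
    change _ = MulAut.conj (b * a⁻¹) • MulAut.conj a • H
    rw [← mul_smul, ← map_mul, inv_mul_cancel_right]
  · obtain ⟨g, hg⟩ := hd U hU
    exact ⟨_, hH.conj_smul g, hg⟩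

theorem le_conj_smul_iff {G : Type*} [Group G] {U H : Subgroup G} {g : G} :
    U ≤ MulAut.conj g • H ↔ ∀ u ∈ U, g⁻¹ * u * g ∈ H := by
  refine forall₂_congr fun u _ => ?_
  rw [Subgroup.mem_pointwise_smul_iff_inv_smul_mem, ← map_inv]
  change g⁻¹ * u * g⁻¹⁻¹ ∈ H ↔ _
  rw [inv_inv]

theorem HasDominantHall.of_surjective {π : Set ℕ} {G B : Type*} [Group G] [Group B]
    {f : G →* B} (hf : Function.Surjective f) (hker : IsPiSubgroup π f.ker)
    (hsol : Group.IsSolvable f.ker) (h : HasDominantHall π B) : HasDominantHall π G := by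
  obtain ⟨H, hH, hHs, hd⟩ := h
  refine ⟨H.comap f, ⟨?_, ?_⟩, ?_, fun U hU => ?_⟩
  · rw [IsPiSubgroup, ← card_map_mul_card_ker_inf f, Subgroup.map_comap_eq_self_of_surjective hf]
    exact hH.1.mul (hker.mono inf_le_left)
  · rw [Subgroup.index_comap_of_surjective _ hf]
    exact hH.2
  · refine Group.isSolvable_of_ker_le_range (Subgroup.inclusion (f.ker_le_comap H))
      (f.subgroupComap H) fun x hx => ?_
    refine ⟨⟨x, ?_⟩, rfl⟩
    exact congrArg Subtype.val (MonoidHom.mem_ker.1 hx)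
  · obtain ⟨b, hb⟩ := hd _ (hU.map f)
    obtain ⟨g, rfl⟩ := hf b
    refine ⟨g, le_conj_smul_iff.2 fun u hu => ?_⟩
    have := le_conj_smul_iff.1 hb (f u) ⟨u, hu, rfl⟩
    rwa [← map_inv, ← map_mul, ← map_mul] at this

theorem HasDominantHall.of_subgroup {π : Set ℕ} {G : Type*} [Group G] {M : Subgroup G}
    (hM : IsPiNumber (primeCompl π) M.index) (h : HasDominantHall π M)
    (hd : ∀ U : Subgroup G, IsPiSubgroup π U → ∃ g : G, U ≤ MulAut.conj g • M) :
    HasDominantHall π G := by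
  obtain ⟨H, hH, hHs, hdM⟩ := h
  refine ⟨H.map M.subtype, ⟨hH.1.map _, ?_⟩,
    Group.isSolvable_of_surjective (M.subtype.subgroupMap_surjective H), fun U hU => ?_⟩
  · rw [Subgroup.index_map_subtype]
    exact hH.2.mul hM
  · obtain ⟨g, hg⟩ := hd U hU
    rw [le_conj_smul_iff] at hg
    have hV : IsPiSubgroup π ((MulAut.conj g⁻¹ • U : Subgroup G).subgroupOf M) := by
      refine IsPiNumber.of_dvd hU ?_
      rw [← card_conj_smul g⁻¹ U]
      exact Subgroup.card_comap_dvd_of_injective _ _ M.subtype_injective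
    obtain ⟨m, hm⟩ := hdM _ hV
    refine ⟨g * m, le_conj_smul_iff.2 fun u hu => ?_⟩
    have h1 := le_conj_smul_iff.1 hm ⟨g⁻¹ * u * g, hg u hu⟩
      (Subgroup.mem_subgroupOf.2 ⟨u, hu, by simp⟩)
    exact ⟨_, h1, by simp [mul_assoc]⟩

/-- The Hall subgroup is a Schur–Zassenhaus complement `W` of the kernel. A `π`-subgroup `U` embeds
in `Q`, so it is soluble; since the kernel is transitive on `G/W`, Glauberman's lemma gives a coset
`gW` fixed by `U`, that is, `U ≤ gWg⁻¹`. -/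
theorem HasDominantHall.of_coprime {π : Set ℕ} {G Q : Type*} [Group G] [Finite G] [Group Q]
    [Finite Q] [hQs : Group.IsSolvable Q] (f : G →* Q) (hQ : IsPiNumber π (Nat.card Q))
    (hker : IsPiNumber (primeCompl π) (Nat.card f.ker)) : HasDominantHall π G := by
  have hidx : IsPiNumber π f.ker.index := by
    rw [Subgroup.index_ker]
    exact hQ.of_dvd (Subgroup.card_subgroup_dvd_card _)
  obtain ⟨W, hW⟩ := Subgroup.exists_right_complement'_of_coprime (hidx.coprime hker).symm
  have hpi : ∀ U : Subgroup G, IsPiSubgroup π U → Group.IsSolvable U := fun U hU => by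
    have h1 : Disjoint U f.ker :=
      Subgroup.disjoint_of_coprime_natCard (IsPiNumber.coprime hU hker)
    refine Group.isSolvable_of_isSolvable_injective (f := f.comp U.subtype)
      ((injective_iff_map_eq_one _).2 fun x hx => Subtype.ext ?_)
    exact Subgroup.disjoint_def.1 h1 x.2 (MonoidHom.mem_ker.2 hx)
  have hWpi : IsPiSubgroup π W := by
    rw [IsPiSubgroup, ← hW.symm.index_eq_card]
    exact hidx
  refine ⟨W, ⟨hWpi, by rwa [hW.index_eq_card]⟩, hpi W hWpi, fun U hU => ?_⟩
  obtain ⟨⟨x, -, hx⟩, -⟩ := glauberman (Ω := G ⧸ W) (Nat.card U) U f.ker le_rfl (hpi U hU)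
    Subgroup.le_normalizer_of_normal (IsPiNumber.coprime hU hker) Set.univ
    ⟨((1 : G) : G ⧸ W), trivial⟩ (fun _ _ _ _ => trivial) (fun _ _ _ _ => trivial) (by
      intro a _ b _
      induction a using QuotientGroup.induction_on with | H a =>
      induction b using QuotientGroup.induction_on with | H b =>
      obtain ⟨⟨n, w⟩, h, -⟩ := hW.existsUnique (a⁻¹ * b)
      refine ⟨a * n * a⁻¹, (inferInstance : f.ker.Normal).conj_mem n n.2 a, ?_⟩
      rw [MulAction.Quotient.smul_coe, QuotientGroup.eq]
      have hb : b = a * (n * w) := by simp only at h; rw [h]; group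
      rw [hb]
      convert w.2 using 1
      simp [mul_assoc])
  induction x using QuotientGroup.induction_on with | H g =>
  refine ⟨g, le_conj_smul_iff.2 fun u hu => ?_⟩
  have := hx u hu
  rw [MulAction.Quotient.smul_coe, eq_comm, QuotientGroup.eq] at this
  simpa [mul_assoc] using this

theorem index_eq_relIndex_of_sup_eq_top {G : Type*} [Group G] [Finite G] {M N : Subgroup G}
    [N.Normal] (h : M ⊔ N = ⊤) : M.index = M.relIndex N := by
  have h1 : N.relIndex M = N.index := by
    rw [← Subgroup.relIndex_sup_right M N, h, Subgroup.relIndex_top_right]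
  have h2 := Subgroup.relIndex_mul_index (inf_le_left : N ⊓ M ≤ N)
  have h3 := Subgroup.relIndex_mul_index (inf_le_right : N ⊓ M ≤ M)
  rw [Subgroup.inf_relIndex_left] at h2
  rw [Subgroup.inf_relIndex_right, h1, ← h2, mul_comm] at h3
  exact Nat.eq_of_mul_eq_mul_right (Nat.pos_of_ne_zero N.index_ne_zero_of_finite) h3

theorem isPGroup_of_unique_prime {G : Type*} [Group G] [Finite G] {p : ℕ}
    (h : ∀ q : ℕ, q.Prime → q ∣ Nat.card G → q = p) : IsPGroup p G :=
  IsPGroup.of_card (Nat.eq_prime_pow_of_unique_prime_dvd Nat.card_pos.ne' fun {q} => h q)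

theorem isSolvable_of_isPGroup {G : Type*} [Group G] [Finite G] {p : ℕ} [Fact p.Prime]
    (h : IsPGroup p G) : Group.IsSolvable G :=
  have := h.isNilpotent
  inferInstance

theorem IsSylowIn.normalizer_sup {G : Type*} [Group G] [Finite G] {p : ℕ} [Fact p.Prime]
    {P N : Subgroup G} [N.Normal] (h : IsSylowIn p P N) :
    Subgroup.normalizer (P : Set G) ⊔ N = ⊤ := by
  rw [eq_top_iff]
  intro g _
  obtain ⟨n, hn, he⟩ := h.exists_conj (h.smul (g := g)
    (by rw [Subgroup.normalizer_eq_top]; trivial))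
  have h1 : n⁻¹ * g ∈ Subgroup.normalizer (P : Set G) := by
    rw [← conj_smul_eq_self_iff, map_mul, mul_smul, ← he, ← mul_smul, ← map_mul, inv_mul_cancel,
      map_one, one_smul]
  rw [show g = n * (n⁻¹ * g) by group]
  exact mul_mem (Subgroup.mem_sup_right hn) (Subgroup.mem_sup_left h1)

/-- By Frattini, the normaliser `M` of a Sylow `p`-subgroup `P` of the kernel has `π'`-index, and in
`M/P` the kernel becomes a `π'`-group. A `π`-subgroup meets the kernel in a `p`-group, so it is
soluble and normalises some conjugate of `P`. -/
theorem HasDominantHall.of_ker {π : Set ℕ} {G : Type u} {Q : Type*} [Group G] [Finite G] [Group Q]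
    [Finite Q] [hQs : Group.IsSolvable Q] (f : G →* Q) (hQ : IsPiNumber π (Nat.card Q))
    (hker : AtMostOnePrime π (Nat.card f.ker)) : HasDominantHall π G := by
  obtain ⟨p, hp, hpπ, huniq⟩ : ∃ p : ℕ, p.Prime ∧ (p ∣ Nat.card f.ker → p ∈ π) ∧
      ∀ q : ℕ, q.Prime → q ∈ π → q ∣ Nat.card f.ker → q = p := by
    by_cases h : ∃ p : ℕ, p.Prime ∧ p ∈ π ∧ p ∣ Nat.card f.ker
    · obtain ⟨p, hp, hpπ, hd⟩ := h
      exact ⟨p, hp, fun _ => hpπ, fun q _ hqπ hqd => hker q hqπ p hpπ hqd hd⟩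
    -- With no prime of `π` available, a prime exceeding the order of the kernel serves, and `P` is
    -- trivial.
    · obtain ⟨p, hle, hp⟩ := Nat.exists_infinite_primes (Nat.card f.ker + 1)
      refine ⟨p, hp, fun hd => absurd (Nat.le_of_dvd Nat.card_pos hd) (by omega),
        fun q hq hqπ hqd => absurd ⟨q, hq, hqπ, hqd⟩ h⟩
  have := Fact.mk hp
  obtain ⟨P, hP⟩ := IsSylowIn.exists_of_subgroup (p := p) f.ker
  have hPpi : IsPiSubgroup π P := by
    intro q hq hqd
    obtain ⟨k, hk⟩ := IsPGroup.iff_card.1 hP.isPGroup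
    have hqp : q = p := (Nat.prime_dvd_prime_iff_eq hq hp).1 (hq.dvd_of_dvd_pow (hk ▸ hqd))
    subst hqp
    exact hpπ (hqd.trans (Subgroup.card_dvd_of_le hP.le))
  have hrel : IsPiNumber (primeCompl π) (P.relIndex f.ker) :=
    isPiNumber_primeCompl.2 fun q hq hqπ hqd => by
      have := huniq q hq hqπ (hqd.trans (Subgroup.relIndex_dvd_card _ _))
      subst this
      exact hP.not_dvd hqd
  set M := Subgroup.normalizer (P : Set G) with hM
  have hPM : P ≤ M := Subgroup.le_normalizer
  refine HasDominantHall.of_subgroup (M := M) ?_ ?_ fun U hU => ?_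
  · rw [index_eq_relIndex_of_sup_eq_top hP.normalizer_sup]
    exact hrel.of_dvd (Subgroup.relIndex_dvd_of_le_left _ hPM)
  · refine HasDominantHall.of_surjective (QuotientGroup.mk'_surjective (P.subgroupOf M)) ?_ ?_ ?_
    · rw [QuotientGroup.ker_mk', IsPiSubgroup,
        Nat.card_congr (Subgroup.subgroupOfEquivOfLe hPM).toEquiv]
      exact hPpi
    · rw [QuotientGroup.ker_mk']
      exact isSolvable_of_isPGroup (hP.isPGroup.comap_subtype (K := M))
    · have hle : P.subgroupOf M ≤ (f.comp M.subtype).ker := fun x hx => hP.le hx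
      refine HasDominantHall.of_coprime (QuotientGroup.lift (P.subgroupOf M) (f.comp M.subtype) hle)
        hQ ?_
      have e : (f.comp M.subtype).ker = (f.ker ⊓ M).subgroupOf M := by
        rw [Subgroup.inf_subgroupOf_right]
        rfl
      rw [QuotientGroup.ker_lift, e, ← Subgroup.relIndex_ker, QuotientGroup.ker_mk',
        Subgroup.relIndex_subgroupOf inf_le_right]
      exact hrel.of_dvd ⟨_, (Subgroup.relIndex_mul_relIndex P (f.ker ⊓ M) f.ker
        (le_inf hP.le hPM) inf_le_left).symm⟩
  · have hUN : IsPGroup p (f.ker ⊓ U : Subgroup G) := isPGroup_of_unique_prime fun q hq hd =>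
      huniq q hq (hU q hq (hd.trans (Subgroup.card_dvd_of_le inf_le_right)))
        (hd.trans (Subgroup.card_dvd_of_le inf_le_left))
    have := isSolvable_of_isPGroup hUN
    have hUs : Group.IsSolvable U :=
      Group.isSolvable_of_ker_le_range (Subgroup.inclusion (inf_le_right : f.ker ⊓ U ≤ U))
        (f.comp U.subtype) fun x hx => ⟨⟨x, hx, x.2⟩, rfl⟩
    obtain ⟨P₁, hP₁, hUP₁⟩ := exists_sylow_le_normalizer (p := p) _ G U f.ker le_rfl hUs
      Subgroup.le_normalizer_of_normal fun q hq hqU hqN => huniq q hq (hU q hq hqU) hqN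
    obtain ⟨n, -, rfl⟩ := hP.exists_conj hP₁
    refine ⟨n, le_conj_smul_iff.2 fun u hu => ?_⟩
    have h1 := conj_smul_eq_self_iff.2 (hUP₁ hu)
    rw [hM, ← conj_smul_eq_self_iff, map_mul, map_mul, mul_smul, mul_smul, h1, ← mul_smul,
      ← map_mul, inv_mul_cancel, map_one, one_smul]

theorem HasDominantHall.of_quotient {π : Set ℕ} {G : Type u} [Group G] [Finite G]
    (N : Subgroup G) [N.Normal] (hN : AtMostOnePrime π (Nat.card N))
    (h : HasDominantHall π (G ⧸ N)) : HasDominantHall π G := by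
  obtain ⟨H, hH, hHs, hd⟩ := h
  have hsurj := QuotientGroup.mk'_surjective N
  refine HasDominantHall.of_subgroup (M := H.comap (QuotientGroup.mk' N)) ?_ ?_ fun U hU => ?_
  · rw [Subgroup.index_comap_of_surjective _ hsurj]
    exact hH.2
  · refine HasDominantHall.of_ker ((QuotientGroup.mk' N).subgroupComap H) hH.1 ?_
    have e : ((QuotientGroup.mk' N).subgroupComap H).ker = N.subgroupOf _ := by
      ext x
      rw [MonoidHom.mem_ker, Subgroup.mem_subgroupOf, ← QuotientGroup.eq_one_iff]
      exact Subtype.ext_iff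
    have hle : N ≤ H.comap (QuotientGroup.mk' N) := by
      conv_lhs => rw [← QuotientGroup.ker_mk' N]
      exact (QuotientGroup.mk' N).ker_le_comap H
    rwa [e, Nat.card_congr (Subgroup.subgroupOfEquivOfLe hle).toEquiv]
  · obtain ⟨b, hb⟩ := hd _ (hU.map (QuotientGroup.mk' N))
    obtain ⟨g, rfl⟩ := hsurj b
    refine ⟨g, le_conj_smul_iff.2 fun u hu => ?_⟩
    have := le_conj_smul_iff.1 hb _ ⟨u, hu, rfl⟩
    rwa [← map_inv, ← map_mul, ← map_mul] at this

/-! ### Permuting subgroups -/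

section Permutes

variable {G : Type*} [Group G] {A A' B : Subgroup G}

theorem permutes_of_forall (h : ∀ a ∈ A, ∀ b ∈ B, ∃ a' ∈ A, ∃ b' ∈ B, b * a = a' * b') :
    Permutes A B := by
  ext x
  simp only [Set.mem_mul, SetLike.mem_coe]
  constructor
  · rintro ⟨a, ha, b, hb, rfl⟩
    obtain ⟨a', ha', b', hb', e⟩ := h a⁻¹ (A.inv_mem ha) b⁻¹ (B.inv_mem hb)
    refine ⟨b'⁻¹, B.inv_mem hb', a'⁻¹, A.inv_mem ha', ?_⟩
    rw [← mul_inv_rev, ← e, mul_inv_rev, inv_inv, inv_inv]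
  · rintro ⟨b, hb, a, ha, rfl⟩
    obtain ⟨a', ha', b', hb', e⟩ := h a ha b hb
    exact ⟨a', ha', b', hb', e.symm⟩

theorem Permutes.exists_mul (h : Permutes A B) {a b : G} (ha : a ∈ A) (hb : b ∈ B) :
    ∃ a' ∈ A, ∃ b' ∈ B, b * a = a' * b' := by
  have : b * a ∈ (A : Set G) * (B : Set G) := by
    rw [h]
    exact Set.mul_mem_mul hb ha
  obtain ⟨a', ha', b', hb', e⟩ := this
  exact ⟨a', ha', b', hb', e.symm⟩

theorem permutes_bot : Permutes (⊥ : Subgroup G) B := by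
  refine permutes_of_forall fun a ha b hb => ⟨1, Subgroup.one_mem _, b, hb, ?_⟩
  rw [Subgroup.mem_bot.1 ha, mul_one, one_mul]

theorem Permutes.exists_of_mem_sup (h : Permutes A B) {x : G} (hx : x ∈ A ⊔ B) :
    ∃ a ∈ A, ∃ b ∈ B, x = a * b := by
  let K : Subgroup G :=
    { carrier := {x | ∃ a ∈ A, ∃ b ∈ B, x = a * b}
      one_mem' := ⟨1, A.one_mem, 1, B.one_mem, (mul_one 1).symm⟩
      mul_mem' := by
        rintro _ _ ⟨a, ha, b, hb, rfl⟩ ⟨c, hc, d, hd, rfl⟩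
        obtain ⟨a', ha', b', hb', e⟩ := h.exists_mul hc hb
        refine ⟨a * a', A.mul_mem ha ha', b' * d, B.mul_mem hb' hd, ?_⟩
        calc a * b * (c * d) = a * (b * c) * d := by group
          _ = a * (a' * b') * d := by rw [e]
          _ = a * a' * (b' * d) := by group
      inv_mem' := by
        rintro _ ⟨a, ha, b, hb, rfl⟩
        obtain ⟨a', ha', b', hb', e⟩ := h.exists_mul (A.inv_mem ha) (B.inv_mem hb)
        exact ⟨a', ha', b', hb', by rw [mul_inv_rev, e]⟩ }
  have hle : A ⊔ B ≤ K := sup_le (fun a ha => ⟨a, ha, 1, B.one_mem, (mul_one a).symm⟩)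
    (fun b hb => ⟨1, A.one_mem, b, hb, (one_mul b).symm⟩)
  exact hle hx

theorem Permutes.sup_left (h : Permutes A B) (h' : Permutes A' B) : Permutes (A ⊔ A') B := by
  refine permutes_of_forall fun a ha => ?_
  rw [sup_eq_iSup] at ha
  refine Subgroup.iSup_induction _ (C := fun a => ∀ b ∈ B, ∃ a' ∈ A ⊔ A', ∃ b' ∈ B,
    b * a = a' * b') ha ?_ ?_ ?_
  · intro i x hx b hb
    cases i with
    | true =>
      obtain ⟨a', ha', b', hb', e⟩ := h.exists_mul hx hb
      exact ⟨a', Subgroup.mem_sup_left ha', b', hb', e⟩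
    | false =>
      obtain ⟨a', ha', b', hb', e⟩ := h'.exists_mul hx hb
      exact ⟨a', Subgroup.mem_sup_right ha', b', hb', e⟩
  · exact fun b hb => ⟨1, Subgroup.one_mem _, b, hb, by rw [mul_one, one_mul]⟩
  · intro x y hx hy b hb
    obtain ⟨x', hx', b', hb', e⟩ := hx b hb
    obtain ⟨y', hy', b'', hb'', e'⟩ := hy b' hb'
    exact ⟨x' * y', mul_mem hx' hy', b'', hb'', by rw [← mul_assoc, e, mul_assoc, e', mul_assoc]⟩

theorem Permutes.map {G' : Type*} [Group G'] (h : Permutes A B) (f : G →* G') :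
    Permutes (A.map f) (B.map f) := by
  refine permutes_of_forall ?_
  rintro _ ⟨a, ha, rfl⟩ _ ⟨b, hb, rfl⟩
  obtain ⟨a', ha', b', hb', e⟩ := h.exists_mul ha hb
  exact ⟨f a', ⟨a', ha', rfl⟩, f b', ⟨b', hb', rfl⟩, by rw [← map_mul, e, map_mul]⟩

theorem Permutes.conj_smul (h : Permutes A B) (g : G) :
    Permutes (MulAut.conj g • A) (MulAut.conj g • B) :=
  h.map (MulAut.conj g).toMonoidHom

theorem conj_smul_conj_smul (g h : G) (A : Subgroup G) :
    MulAut.conj g • MulAut.conj h • A = MulAut.conj (g * h) • A := by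
  rw [map_mul, mul_smul]

/-- Kegel's lemma for simple groups: if a nontrivial subgroup `A` permutes with all conjugates of
a nontrivial subgroup `B`, then `AB` is the whole group. -/
theorem sup_eq_top_of_permutes_conj [Finite G] [IsSimpleGroup G] (hA : A ≠ ⊥) (hB : B ≠ ⊥)
    (h : ∀ g : G, Permutes A (MulAut.conj g • B)) : A ⊔ B = ⊤ := by
  -- If `C` and one conjugate of `B` generate `G`, so do `C` and any other: writing `lk⁻¹ = cb` with
  -- `b` in the `k`-conjugate, the `l`-conjugate is its image under `c`.
  have hall : ∀ C : Subgroup G, (∀ g : G, Permutes C (MulAut.conj g • B)) →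
      ∀ k l : G, C ⊔ MulAut.conj k • B = ⊤ → C ⊔ MulAut.conj l • B = ⊤ := by
    intro C hC k l hk
    obtain ⟨c, hc, b, hb, e⟩ := (hC k).exists_of_mem_sup (x := l * k⁻¹) (hk ▸ Subgroup.mem_top _)
    have hl : MulAut.conj l • B = MulAut.conj c • MulAut.conj k • B := by
      rw [show l = c * b * k by rw [← e]; group, ← conj_smul_conj_smul, ← conj_smul_conj_smul,
        Subgroup.conj_smul_eq_self_of_mem hb]
    rw [eq_top_iff, ← hk]
    refine sup_le le_sup_left fun x hx => ?_
    have hc' : c ∈ C ⊔ MulAut.conj l • B := Subgroup.mem_sup_left hc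
    have hx' : c * x * c⁻¹ ∈ C ⊔ MulAut.conj l • B := by
      refine Subgroup.mem_sup_right ?_
      rw [hl]
      exact Subgroup.smul_mem_pointwise_smul x (MulAut.conj c) _ hx
    have := mul_mem (mul_mem (inv_mem hc') hx') hc'
    rwa [show c⁻¹ * (c * x * c⁻¹) * c = x by group] at this
  by_contra hne
  have h1 : ∀ g : G, A ⊔ MulAut.conj g • B ≠ ⊤ := fun g hg => hne <| by
    simpa using hall A h g 1 hg
  obtain ⟨C, hAC, ⟨hC, hCne⟩, hmax⟩ := (Set.toFinite {C : Subgroup G |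
    (∀ g : G, Permutes C (MulAut.conj g • B)) ∧
      ∀ g : G, C ⊔ MulAut.conj g • B ≠ ⊤}).exists_le_maximal ⟨h, h1⟩
  -- Adjoining to the maximal `C` its conjugate by `b` keeps both defining properties, as the join
  -- still lies in `C ⊔ gBg⁻¹`. So all conjugates of `B` normalise `C`; they generate `G`, and `C`
  -- is normal.
  have hnorm : ∀ g : G, ∀ b ∈ (MulAut.conj g • B : Subgroup G), MulAut.conj b • C ≤ C := by
    intro g b hb
    have hperm : ∀ k : G, Permutes (C ⊔ MulAut.conj b • C) (MulAut.conj k • B) := by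
      intro k
      refine (hC k).sup_left ?_
      have := (hC (b⁻¹ * k)).conj_smul b
      rwa [conj_smul_conj_smul, mul_inv_cancel_left] at this
    refine le_sup_right.trans (hmax ⟨hperm, fun k hk => hCne g ?_⟩ le_sup_left)
    have h2 := hall _ hperm k g hk
    rw [eq_top_iff, ← h2]
    refine sup_le (sup_le le_sup_left ?_) le_sup_right
    have hb' : b ∈ C ⊔ MulAut.conj g • B := Subgroup.mem_sup_right hb
    rw [← Subgroup.conj_smul_eq_self_of_mem hb']
    exact Subgroup.pointwise_smul_le_pointwise_smul_iff.2 le_sup_left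
  have hcl : Subgroup.normalClosure (B : Set G) ≤ Subgroup.normalizer (C : Set G) := by
    rw [Subgroup.normalClosure, Subgroup.closure_le]
    intro x hx
    obtain ⟨b, hb, hbx⟩ := Group.mem_conjugatesOfSet_iff.1 hx
    obtain ⟨g, rfl⟩ := isConj_iff.1 hbx
    have hmem : g * b * g⁻¹ ∈ (MulAut.conj g • B : Subgroup G) :=
      Subgroup.smul_mem_pointwise_smul b (MulAut.conj g) B hb
    rw [SetLike.mem_coe, ← conj_smul_eq_self_iff]
    exact Subgroup.eq_of_le_of_card_ge (hnorm g _ hmem) (card_conj_smul _ _).ge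
  have htop : Subgroup.normalClosure (B : Set G) = ⊤ :=
    (IsSimpleGroup.eq_bot_or_eq_top_of_normal _ Subgroup.normalClosure_normal).resolve_left
      fun h0 => hB (le_bot_iff.1 (h0 ▸ Subgroup.le_normalClosure))
  have hCn : C.Normal := Subgroup.normalizer_eq_top_iff.1 (top_le_iff.1 (htop ▸ hcl))
  rcases IsSimpleGroup.eq_bot_or_eq_top_of_normal C hCn with h0 | h0
  · exact hA (le_bot_iff.1 (h0 ▸ hAC))
  · exact hCne 1 (by rw [h0, top_sup_eq])

end Permutes

/-! ### Coprime indices and intersections with normal subgroups -/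

section Index

variable {G : Type*} [Group G]

theorem index_dvd_card_of_sup {A B : Subgroup G} (h : Permutes A B) (ht : A ⊔ B = ⊤) :
    A.index ∣ Nat.card B := by
  have := card_dvd_of_transitive B (Set.univ : Set (G ⧸ A)) (ω := ((1 : G) : G ⧸ A)) trivial
    (fun _ _ _ _ => trivial) fun x _ => by
      induction x using QuotientGroup.induction_on with | H g =>
      obtain ⟨a, ha, b, hb, e⟩ := h.exists_of_mem_sup (x := g⁻¹) (ht ▸ Subgroup.mem_top _)
      refine ⟨b⁻¹, B.inv_mem hb, ?_⟩
      rw [MulAction.Quotient.smul_coe, QuotientGroup.eq]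
      have : g = b⁻¹ * a⁻¹ := by rw [← mul_inv_rev, ← e, inv_inv]
      rw [this]
      simpa using ha
  rwa [Nat.card_coe_set_eq, Set.ncard_univ, ← Subgroup.index_eq_card] at this

variable [Finite G]

theorem relIndex_dvd_index_of_normal_right (H N : Subgroup G) [N.Normal] :
    H.relIndex N ∣ H.index := by
  obtain ⟨c, hc⟩ := Subgroup.relIndex_dvd_index_of_normal N H
  have h2 := Subgroup.relIndex_mul_index (inf_le_right : H ⊓ N ≤ N)
  have h3 := Subgroup.relIndex_mul_index (inf_le_left : H ⊓ N ≤ H)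
  rw [Subgroup.inf_relIndex_right] at h2
  rw [Subgroup.inf_relIndex_left, ← h2, hc, mul_left_comm] at h3
  have hpos : 0 < N.relIndex H :=
    Nat.pos_of_ne_zero (N.subgroupOf H).index_ne_zero_of_finite
  exact ⟨c, Nat.eq_of_mul_eq_mul_left hpos h3⟩

theorem relIndex_inf_dvd_relIndex {H K : Subgroup G} (N : Subgroup G) [N.Normal] :
    H.relIndex (K ⊓ N) ∣ H.relIndex K := by
  have h := relIndex_dvd_index_of_normal_right (H.subgroupOf K) (N.subgroupOf K)
  have e : N.subgroupOf K = (K ⊓ N).subgroupOf K := by rw [Subgroup.inf_subgroupOf_left]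
  rwa [e, Subgroup.relIndex_subgroupOf inf_le_left] at h

/-- Coprimality makes `|G : B|` divide `|A : A ∩ B|`, so `A` is transitive on `G/B`. -/
theorem exists_mul_of_coprime_index {A B : Subgroup G} (h : A.index.Coprime B.index) (x : G) :
    ∃ a ∈ A, ∃ b ∈ B, x = a * b := by
  have h2 := Subgroup.relIndex_mul_index (inf_le_left : A ⊓ B ≤ A)
  have h3 := Subgroup.relIndex_mul_index (inf_le_right : A ⊓ B ≤ B)
  rw [Subgroup.inf_relIndex_left] at h2
  rw [Subgroup.inf_relIndex_right, ← h2] at h3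
  have hd : B.index ∣ B.relIndex A := h.symm.dvd_of_dvd_mul_right ⟨_, by rw [← h3, mul_comm]⟩
  have hst : (MulAction.stabilizer A ((1 : G) : G ⧸ B)) = B.subgroupOf A := by
    ext a
    rw [MulAction.mem_stabilizer_iff, Subgroup.mem_subgroupOf, eq_comm]
    change ((1 : G) : G ⧸ B) = ((a * 1 : G) : G ⧸ B) ↔ _
    rw [QuotientGroup.eq]
    simp
  have hcard : Nat.card (MulAction.orbit A ((1 : G) : G ⧸ B)) = B.relIndex A := by
    rw [Nat.card_congr (MulAction.orbitEquivQuotientStabilizer A ((1 : G) : G ⧸ B)), hst]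
    rfl
  have huniv : MulAction.orbit A ((1 : G) : G ⧸ B) = Set.univ := by
    refine Set.eq_of_subset_of_ncard_le (Set.subset_univ _) ?_
    rw [Set.ncard_univ, ← Subgroup.index_eq_card, ← Nat.card_coe_set_eq, hcard]
    exact Nat.le_of_dvd (Nat.pos_of_ne_zero (B.subgroupOf A).index_ne_zero_of_finite) hd
  obtain ⟨a, ha⟩ : (x : G ⧸ B) ∈ MulAction.orbit A ((1 : G) : G ⧸ B) := huniv ▸ Set.mem_univ _
  have ha' : ((a * 1 : G) : G ⧸ B) = x := ha
  rw [QuotientGroup.eq, mul_one] at ha'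
  exact ⟨a, a.2, _, ha', by group⟩

/-- In `L = AQ` the index of `A` is a power of `q` and that of `Q` is prime to `q`. Intersecting
with `N` replaces both indices by divisors, so they stay coprime and `L ∩ N` is the product of `A ∩
N` and `Q ∩ N`. -/
theorem Permutes.subgroupOf {q : ℕ} [hq : Fact q.Prime] {A : Subgroup G} {Q : Sylow q G}
    (h : Permutes A (Q : Subgroup G)) (N : Subgroup G) [N.Normal] :
    Permutes (A.subgroupOf N) ((Q : Subgroup G).subgroupOf N) := by
  set L := A ⊔ (Q : Subgroup G) with hL
  set M := L ⊓ N with hM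
  have hAL : A.relIndex L ∣ Nat.card Q := by
    have h1 := index_dvd_card_of_sup (A := A.subgroupOf L) (B := (Q : Subgroup G).subgroupOf L)
      (permutes_of_forall fun a ha b hb => by
        obtain ⟨a', ha', b', hb', e⟩ := h.exists_mul ha hb
        exact ⟨⟨a', Subgroup.mem_sup_left ha'⟩, ha', ⟨b', Subgroup.mem_sup_right hb'⟩, hb',
          Subtype.ext e⟩)
      (by rw [← Subgroup.subgroupOf_sup le_sup_left le_sup_right, Subgroup.subgroupOf_self])
    rwa [Nat.card_congr (Subgroup.subgroupOfEquivOfLe (le_sup_right)).toEquiv] at h1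
  have hcop : (A.relIndex M).Coprime ((Q : Subgroup G).relIndex M) := by
    refine Nat.Coprime.coprime_dvd_left ((relIndex_inf_dvd_relIndex N).trans hAL) ?_
    refine Nat.Coprime.coprime_dvd_right ((relIndex_inf_dvd_relIndex N).trans
      (Subgroup.relIndex_dvd_index_of_le le_sup_right)) ?_
    exact Q.card_coprime_index
  refine permutes_of_forall fun a ha b hb => ?_
  have hmem : ((b * a : N) : G) ∈ M :=
    ⟨mul_mem (Subgroup.mem_sup_right hb) (Subgroup.mem_sup_left ha), (b * a).2⟩
  obtain ⟨a', ha', b', hb', e⟩ := exists_mul_of_coprime_index (A := A.subgroupOf M)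
    (B := (Q : Subgroup G).subgroupOf M) hcop ⟨_, hmem⟩
  exact ⟨⟨a', a'.2.2⟩, ha', ⟨b', b'.2.2⟩, hb', Subtype.ext (congrArg (fun z : M => (z : G)) e)⟩

end Index

/-! ### Chains of subgroups permuting with Sylow subgroups -/

/-- `G` has a chain of subgroups, from `1` to `G`, with indices divisible by at most one prime of
`π`, which permute with all Sylow `q`-subgroups for `q ∈ π`. -/
def HasPermutableChain (π : Set ℕ) (G : Type*) [Group G] : Prop :=
  ∃ (t : ℕ) (H : ℕ → Subgroup G), H 0 = ⊥ ∧ H t = ⊤ ∧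
    (∀ i < t, H i ≤ H (i + 1) ∧ AtMostOnePrime π ((H i).relIndex (H (i + 1)))) ∧
    ∀ i ≤ t, ∀ q ∈ π, ∀ Q : Sylow q G, Permutes (H i) (Q : Subgroup G)

theorem AtMostOnePrime.of_dvd {π : Set ℕ} {m n : ℕ} (h : AtMostOnePrime π n) (hmn : m ∣ n) :
    AtMostOnePrime π m :=
  fun p hp q hq hpm hqm => h p hp q hq (hpm.trans hmn) (hqm.trans hmn)

namespace HasPermutableChain

variable {π : Set ℕ} {G : Type u} [Group G] [Finite G]

theorem of_surjective (hπ : ∀ p ∈ π, p.Prime) {B : Type*} [Group B] {f : G →* B}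
    (hf : Function.Surjective f) (h : HasPermutableChain π G) : HasPermutableChain π B := by
  obtain ⟨t, H, h0, ht, hi, hp⟩ := h
  refine ⟨t, fun i => (H i).map f, ?_, ?_, fun i hit => ⟨Subgroup.map_mono (hi i hit).1, ?_⟩,
    fun i hit q hq Q => ?_⟩
  · simp only [h0, Subgroup.map_bot]
  · simp only [ht, Subgroup.map_top_of_surjective f hf]
  · refine (hi i hit).2.of_dvd ?_
    rw [← Subgroup.relIndex_comap]
    exact Subgroup.relIndex_dvd_of_le_left _ (Subgroup.le_comap_map f _)
  · have := Fact.mk (hπ q hq)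
    obtain ⟨P, rfl⟩ := Sylow.mapSurjective_surjective hf q Q
    exact (hp i hit q hq P).map f

theorem normal (hπ : ∀ p ∈ π, p.Prime) (h : HasPermutableChain π G) (N : Subgroup G) [N.Normal] :
    HasPermutableChain π N := by
  obtain ⟨t, H, h0, ht, hi, hp⟩ := h
  refine ⟨t, fun i => (H i).subgroupOf N, ?_, ?_, fun i hit =>
    ⟨Subgroup.comap_mono (hi i hit).1, ?_⟩, fun i hit q hq Q => ?_⟩
  · simp only [h0, Subgroup.bot_subgroupOf]
  · simp only [ht, Subgroup.top_subgroupOf]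
  · refine (hi i hit).2.of_dvd ?_
    beta_reduce
    rw [← Subgroup.inf_subgroupOf_right (H (i + 1)), Subgroup.relIndex_subgroupOf inf_le_right]
    exact relIndex_inf_dvd_relIndex N
  · have := Fact.mk (hπ q hq)
    obtain ⟨P, hP⟩ := Q.exists_comap_subtype_eq
    rw [← hP]
    exact (hp i hit q hq P).subgroupOf N

theorem atMostOnePrime_card_of_isSimpleGroup (hπ : ∀ p ∈ π, p.Prime) [IsSimpleGroup G]
    (h : HasPermutableChain π G) : AtMostOnePrime π (Nat.card G) := by
  obtain ⟨t, H, h0, ht, hi, hp⟩ := h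
  -- `H i` is a proper term followed by the whole group.
  obtain ⟨i, hit, hne, htop⟩ : ∃ i < t, H i ≠ ⊤ ∧ H (i + 1) = ⊤ := by
    by_contra! hcon
    have : ∀ i ≤ t, H i ≠ ⊤ := by
      intro i
      induction i with
      | zero => exact fun _ => h0 ▸ bot_ne_top
      | succ i ih => exact fun hle => hcon i hle (ih (by omega))
    exact this t le_rfl ht
  have hidx := (hi i hit).2
  rw [htop, Subgroup.relIndex_top_right] at hidx
  by_cases hbot : H i = ⊥
  · rwa [hbot, Subgroup.index_bot] at hidx
  have key : ∀ p ∈ π, p ∣ Nat.card G → ∃ k : ℕ, (H i).index ∣ p ^ k := by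
    intro p hpπ hd
    have := Fact.mk (hπ p hpπ)
    let Q : Sylow p G := default
    obtain ⟨k, hk⟩ := IsPGroup.iff_card.1 Q.2
    refine ⟨k, hk ▸ index_dvd_card_of_sup (hp i hit.le p hpπ Q) ?_⟩
    exact sup_eq_top_of_permutes_conj hbot (Q.ne_bot_of_dvd_card hd)
      fun g => hp i hit.le p hpπ (g • Q)
  intro p hpπ q hqπ hpd hqd
  by_contra hpq
  obtain ⟨k, hk⟩ := key p hpπ hpd
  obtain ⟨l, hl⟩ := key q hqπ hqd
  exact hne (Subgroup.index_eq_one.1 (Nat.eq_one_of_dvd_coprimes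
    (Nat.coprime_pow_primes k l (hπ p hpπ) (hπ q hqπ) hpq) hk hl))

/-- For a maximal normal subgroup `M` of `N`, the simple group `N/M` already involves every prime `q
∈ π` dividing `|N|`. Otherwise `M` contains all elements of order `q` in `N`, hence the normal
closure in `G` of one of them, which is `N` by minimality. -/
theorem atMostOnePrime_card_of_minimal_normal (hπ : ∀ p ∈ π, p.Prime)
    (h : HasPermutableChain π G) {N : Subgroup G} [hN : N.Normal] (hne : N ≠ ⊥)
    (hmin : ∀ K : Subgroup G, K.Normal → K ≠ ⊥ → K ≤ N → N ≤ K) :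
    AtMostOnePrime π (Nat.card N) := by
  have hnt : Nontrivial N := N.nontrivial_iff_ne_bot.2 hne
  obtain ⟨M, ⟨hMn, hMt⟩, hmax⟩ := (Set.toFinite {M : Subgroup N | M.Normal ∧ M ≠ ⊤}).exists_maximal
    ⟨⊥, inferInstance, bot_ne_top⟩
  have hsurj := QuotientGroup.mk'_surjective M
  have hMlt : M < ⊤ := hMt.lt_top
  have hsimple : IsSimpleGroup (N ⧸ M) :=
    { exists_pair_ne := (QuotientGroup.nontrivial_iff.2 hMt).exists_pair_ne
      eq_bot_or_eq_top_of_normal := fun K hK => by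
        by_cases hK' : K.comap (QuotientGroup.mk' M) = ⊤
        · right
          rw [← Subgroup.map_comap_eq_self_of_surjective hsurj K, hK',
            Subgroup.map_top_of_surjective _ hsurj]
        · left
          have hle : M ≤ K.comap (QuotientGroup.mk' M) := by
            conv_lhs => rw [← QuotientGroup.ker_mk' M]
            exact (QuotientGroup.mk' M).ker_le_comap K
          have h1 := hmax ⟨hK.comap _, hK'⟩ hle
          rw [← Subgroup.map_comap_eq_self_of_surjective hsurj K, eq_bot_iff,
            Subgroup.map_le_iff_le_comap]
          refine h1.trans ?_
          conv_lhs => rw [← QuotientGroup.ker_mk' M]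
          exact (QuotientGroup.mk' M).ker_le_comap ⊥ }
  have hone := ((h.normal hπ N).of_surjective hπ hsurj).atMostOnePrime_card_of_isSimpleGroup hπ
  have key : ∀ q ∈ π, q ∣ Nat.card N → q ∣ Nat.card (N ⧸ M) := by
    intro q hq hd
    have hqp := hπ q hq
    have := Fact.mk hqp
    by_contra hnd
    obtain ⟨x, hx⟩ := exists_prime_orderOf_dvd_card' q hd
    have hmem : ∀ y : N, y ^ q = 1 → y ∈ M := by
      intro y hy
      rw [← QuotientGroup.eq_one_iff, ← orderOf_eq_one_iff]
      refine Nat.eq_one_of_dvd_coprimes ((Nat.Prime.coprime_iff_not_dvd hqp).2 hnd)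
        (orderOf_dvd_of_pow_eq_one ?_) (orderOf_dvd_natCard _)
      rw [← QuotientGroup.mk_pow, hy, QuotientGroup.mk_one]
    have hxq : (x : G) ^ q = 1 := by
      have : x ^ q = 1 := hx ▸ pow_orderOf_eq_one x
      exact_mod_cast congrArg Subtype.val this
    have hle : Subgroup.normalClosure {(x : G)} ≤ M.map N.subtype := by
      rw [Subgroup.normalClosure, Subgroup.closure_le]
      intro y hy
      obtain ⟨b, hb, hby⟩ := Group.mem_conjugatesOfSet_iff.1 hy
      rw [Set.mem_singleton_iff] at hb
      subst hb
      obtain ⟨g, rfl⟩ := isConj_iff.1 hby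
      refine ⟨⟨_, hN.conj_mem x x.2 g⟩, hmem _ (Subtype.ext ?_), rfl⟩
      simp [hxq]
    have hNM : N ≤ M.map N.subtype := (hmin (Subgroup.normalClosure {(x : G)})
      Subgroup.normalClosure_normal (fun h0 => by
        have h1 : (x : G) ∈ Subgroup.normalClosure {(x : G)} :=
          Subgroup.subset_normalClosure rfl
        rw [h0, Subgroup.mem_bot] at h1
        have h2 : x = 1 := Subtype.ext h1
        rw [h2, orderOf_one] at hx
        exact hqp.one_lt.ne hx)
      (hle.trans (Subgroup.map_subtype_le M))).trans hle
    refine hMt (eq_top_iff.2 fun y _ => ?_)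
    obtain ⟨z, hz, hzy⟩ := hNM y.2
    rwa [← show z = y from Subtype.ext hzy]
  exact fun p hp q hq hpd hqd => hone p hp q hq (key p hp hpd) (key q hq hqd)

theorem hasDominantHall (hπ : ∀ p ∈ π, p.Prime) (n : ℕ) :
    ∀ (G : Type u) [Group G] [Finite G], Nat.card G ≤ n → HasPermutableChain π G →
      HasDominantHall π G := by
  induction n with
  | zero =>
    intro G _ _ hcard
    have : 0 < Nat.card G := Nat.card_pos
    omega
  | succ n ih =>
    intro G _ _ hcard h
    rcases subsingleton_or_nontrivial G with hs | hnt
    · have h1 : ∀ (σ : Set ℕ) (K : Type u) [Subsingleton K] [Nonempty K],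
          IsPiNumber σ (Nat.card K) := fun σ K _ _ p hp hd => by
        rw [Nat.card_unique] at hd
        exact absurd (Nat.dvd_one.1 hd) hp.one_lt.ne'
      exact HasDominantHall.of_coprime (MonoidHom.id G) (h1 _ _) (h1 _ _)
    obtain ⟨N, ⟨hN, hne⟩, hmin⟩ := (Set.toFinite {N : Subgroup G | N.Normal ∧ N ≠ ⊥}).exists_minimal
      ⟨⊤, inferInstance, top_ne_bot⟩
    refine HasDominantHall.of_quotient N (h.atMostOnePrime_card_of_minimal_normal hπ hne
      fun K hK hK0 hKN => hmin ⟨hK, hK0⟩ hKN) (ih _ ?_ (h.of_surjective hπ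
        (QuotientGroup.mk'_surjective N)))
    have h1 := N.card_mul_index
    rw [Subgroup.index_eq_card] at h1
    have h2 : 1 < Nat.card N := N.one_lt_card_iff_ne_bot.2 hne
    have h3 : 0 < Nat.card (G ⧸ N) := Nat.card_pos
    nlinarith

end HasPermutableChain

/-- If `A` permutes with all subgroups of `T` and `G = AT`, then `A` permutes with all conjugates
of subgroups of `T`. -/
theorem IsQuasinormalIn.permutes_conj {G : Type*} [Group G] {A T K : Subgroup G}
    (h : IsQuasinormalIn A T) (hAT : (A : Set G) * (T : Set G) = Set.univ) (hK : K ≤ T) (g : G) :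
    Permutes A (MulAut.conj g • K) := by
  obtain ⟨a, ha, t, ht, rfl⟩ : g ∈ (A : Set G) * (T : Set G) := hAT ▸ Set.mem_univ g
  have h1 : MulAut.conj t • K ≤ T := by
    conv_rhs => rw [← Subgroup.conj_smul_eq_self_of_mem ht]
    exact Subgroup.pointwise_smul_le_pointwise_smul_iff.2 hK
  have h2 := (h _ h1).conj_smul a
  rwa [Subgroup.conj_smul_eq_self_of_mem ha, conj_smul_conj_smul] at h2


end PiGroup


/-! ### From quasinormality in `T` to permutability with Sylow subgroups of `G` -/

theorem corollary5p4 {G : Type*} [Group G] [Finite G]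
    (π : Set ℕ) (hπ : ∀ p ∈ π, p.Prime)
    (t : ℕ) (ht : 1 ≤ t) (H : ℕ → Subgroup G)
    (hbot : H 0 = ⊥) (hlt : H 0 < H 1) (hle : ∀ i, i < t → H i ≤ H (i + 1)) (htop : H t = ⊤)
    (hindex : ∀ i, i < t → PiGroup.AtMostOnePrime π ((H i).relIndex (H (i + 1))))
    (T : Subgroup G) (hprod : (H 1 : Set G) * (T : Set G) = Set.univ)
    (hT : PiGroup.IsPiNumber (PiGroup.primeCompl π) T.index)
    (hquasi : ∀ i, 1 ≤ i → i ≤ t → PiGroup.IsQuasinormalIn (H i) T) :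
    PiGroup.IsDSGroup G π := by
  refine (PiGroup.HasPermutableChain.hasDominantHall hπ (Nat.card G) G le_rfl
    ⟨t, H, hbot, htop, fun i hi => ⟨hle i hi, hindex i hi⟩, fun i hit q hq Q => ?_⟩).isDSGroup
  rcases Nat.eq_zero_or_pos i with rfl | hi
  · rw [hbot]
    exact PiGroup.permutes_bot
  have hqp := hπ q hq
  have := Fact.mk hqp
  have hmono : H 1 ≤ H i := by
    clear Q
    induction i, hi using Nat.le_induction with
    | base => exact le_rfl
    | succ j hj ih => exact (ih (by omega)).trans (hle j (by omega))
  have hprod' : (H i : Set G) * (T : Set G) = Set.univ :=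
    Set.eq_univ_of_subset (Set.mul_subset_mul_right hmono) hprod
  obtain ⟨S, hS⟩ := PiGroup.IsSylowIn.exists_of_subgroup (p := q) T
  -- As `|G : T|` is prime to `q`, a Sylow `q`-subgroup of `T` is Sylow in `G`, and `Q` is conjugate
  -- to it.
  have hSG : ¬ q ∣ S.index := by
    rw [← Subgroup.relIndex_mul_index hS.le, hqp.dvd_mul]
    exact not_or.2 ⟨hS.not_dvd, PiGroup.isPiNumber_primeCompl.1 hT q hqp hq⟩
  obtain ⟨g, hg⟩ := MulAction.exists_smul_eq G (hS.isPGroup.toSylow hSG) Q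
  rw [← hg]
  exact (hquasi i hi hit).permutes_conj hprod' hS.le g
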